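/- \textbf{Model.} Let $S$ be a finite set, $A$ a measurable space whose singletons are measurable (for instance a Polish space with its Borel $\sigma$-algebra), and for each $x\in S$ let $A(x)\subseteq A$ be finite; put $K=\{(x,a): x\in S,\ a\in A(x)\}$. Let $q(y|x,a)$, for $(x,a)\in K$ and $y\in S$, be real numbers with $q(y|x,a)\ge 0$ for $y\neq x$ and $\sum_{y\in S}q(y|x,a)=0$. Let $r,c_1,\dots,c_N:K\to\mathbb R$, $d_1,\dots,d_N\in\mathbb R$ with $N\ge 0$, let $\alpha>0$, let $\gamma$ be a probability distribution on $S$, and put $c_0:=-r$. \textbf{Policies.} Let $S_\infty=S\cup\{x_\infty\}$, $A_\infty=A\cup\{a_\infty\}$ with isolated points $x_\infty,a_\infty$, and $A(x_\infty)=\{a_\infty\}$. Let $\Omega$ be the space of sequences $e=(x_0,\theta_1,x_1,\theta_2,x_2,\dots)$ with $x_0\in S$ and, for $k\ge1$, either $(\theta_k,x_k)\in(0,\infty)\times S$ or $(\theta_k,x_k)=(\infty,x_\infty)$, the latter being absorbing. Put $T_0=0$, $T_k=\theta_1+\dots+\theta_k$, $T_\infty=\lim_k T_k$, and $\xi_{0-}=x_0$,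 $\xi_{t-}=x_k$ for $T_k<t\le T_{k+1}$, $\xi_{t-}=x_\infty$ for $t\ge T_\infty$. Let $\mathcal F_t$ be generated by the variables $\#\{k: T_k\le s,\ x_k\in D\}$, $s\le t$, $D\subseteq S$, let $\mathcal F_{s-}=\bigvee_{t<s}\mathcal F_t$, and let the predictable $\sigma$-algebra on $\Omega\times[0,\infty)$ be generated by the sets $B\times\{0\}$ ($B\in\mathcal F_0$) and $C\times(s,\infty)$ ($s>0$, $C\in\mathcal F_{s-}$). A policy $\pi\in\Pi$ is a transition probability $\pi(da|e,t)$ from $\Omega\times[0,\infty)$ with the predictable $\sigma$-algebra to $A_\infty$ such that $\pi(A(\xi_{t-}(e))|e,t)=1$ for all $(e,t)$. A family $\phi(\cdot|x)$, $x\in S$, of probability distributions with $\phi(A(x)|x)=1$ determines the randomized stationary policy $\pi(da|e,t)=I_{\{t<T_\infty\}}\phi(da|\xi_{t-})+I_{\{t\ge T_\infty\}}\delta_{a_\infty}(da)$, also denoted by $\phi$. \textbf{Law and criteria.} By predictability, for $x_k\in S$ and $t>0$, the number $m_k(y|h_k,t)=I_{\{y\ne x_k\}}\sum_{a\in A(x_k)}\pi(\{a\}|e,T_k+t)\,q(y|x_k,a)$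 is the same for all $e\in\Omega$ with $k$-component history $h_k=(x_0,\theta_1,\dots,\theta_k,x_k)$ and $\theta_{k+1}\ge t$. Let $m_k(S|\cdot)=\sum_y m_k(y|\cdot)$. Let $P^\pi_x$ be the probability measure on $\Omega$ with $x_0=x$ under which, given $h_k$ with $x_k\in S$, the pair $(\theta_{k+1},x_{k+1})$ has law $m_k(y|h_k,t)e^{-\int_0^t m_k(S|h_k,v)dv}\,dt$ on $(0,\infty)\times\{y\}$, $y\in S$, and mass $e^{-\int_0^\infty m_k(S|h_k,v)dv}$ at $(\infty,x_\infty)$. For $u:K\to\mathbb R$ let $$V(\pi,u)=\sum_{x\in S}\gamma(x)\int_0^\infty e^{-\alpha t}E^\pi_x\Big[\int_A u(\xi_{t-},a)\,\pi(da|e,t)\Big]dt .$$ A policy $\pi^*$ is constrained optimal if it belongs to $U=\{\pi\in\Pi: V(\pi,c_n)\le d_n,\ 1\le n\le N\}$ and $V(\pi^*,r)=\sup_{\pi\in U}V(\pi,r)$. The number of randomizations of $\phi$ is $\#(\phi)=\sum_{x\in S}m(x,\phi)$, where $m(x,\phi)+1$ is the number of $a\in A(x)$ with $\phi(a|x)>0$.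 \textbf{Linear program.} Minimize $\sum_{(x,a)\in K}\frac1\alpha c_0(x,a)\eta(x,a)$ over $\eta:K\to[0,\infty)$ subject to $$\sum_{(x,a)\in K}c_n(x,a)\eta(x,a)\le\alpha d_n\ (1\le n\le N),\qquad \alpha\sum_{a\in A(x)}\eta(x,a)=\alpha\gamma(x)+\sum_{(y,a)\in K}q(x|y,a)\eta(y,a)\ (x\in S).$$ A feasible $\eta$ is basic if, in the standard form with one slack variable for each of the $N$ inequalities, all variables outside some set whose columns form a basis of the column space vanish. \textbf{Statement.} Let $\eta^*$ be an optimal basic solution of this linear program, let $\hat\eta^*(x)=\sum_{a\in A(x)}\eta^*(x,a)$, choose $a(x)\in A(x)$ arbitrarily for each $x\in S$, and for $x \in S$, $a\in A(x)$ put $$\phi^{\eta^*}(a|x)=\begin{cases}\eta^*(x,a)/\hat\eta^*(x),&\hat\eta^*(x)>0,\\ I_{\{a(x)\}}(a),&\hat\eta^*(x)=0.\end{cases}$$ Then $\phi^{\eta^*}(\cdot|x)$ is a probability distribution on $A(x)$ for every $x\in S$, the randomized stationary policy $\phi^{\eta^*}$ belongs to $\Pi$ and is constrained optimal, and $\#(\phi^{\eta^*})\le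 N$. -/

import Mathlib

open MeasureTheory ProbabilityTheory Set
open scoped ENNReal NNReal

/-- Adjoining an isolated point `none` to a measurable space: a set is measurable iff its trace on
the original space is. -/
instance Option.instMeasurableSpaceIsolated {X : Type*} [MeasurableSpace X] :
    MeasurableSpace (Option X) :=
  MeasurableSpace.map some inferInstance

theorem Option.measurableSet_iff_isolated {X : Type*} [MeasurableSpace X] {s : Set (Option X)} :
    MeasurableSet s ↔ MeasurableSet (some ⁻¹' s) := Iff.rfl

instance Option.instMeasurableSingletonClassIsolated {X : Type*} [MeasurableSpace X]
    [MeasurableSingletonClass X] : MeasurableSingletonClass (Option X) where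
  measurableSet_singleton o := by
    rw [Option.measurableSet_iff_isolated]
    cases o with
    | none => convert MeasurableSet.empty; ext; simp
    | some x => convert measurableSet_singleton x; ext; simp

namespace CTMDP

/-- A discounted constrained continuous-time Markov decision model with finite state space `S`,
finite sets `Adm x` of admissible actions, `N` constraints, discount factor `α`
and initial distribution `γ`.  The functions `q`, `r`, `c n` live on the set of admissible
pairs; `q x a y` is the transition rate `q({y} | x, a)`. -/
structure Model (S A : Type*) [Fintype S] (N : ℕ) where
  Adm : S → Finset A
  q : (x : S) → Adm x → S → ℝ
  q_nonneg : ∀ x a y, y ≠ x → 0 ≤ q x a y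
  q_sum : ∀ x a, ∑ y, q x a y = 0
  r : (x : S) → Adm x → ℝ
  c : Fin N → (x : S) → Adm x → ℝ
  d : Fin N → ℝ
  α : ℝ
  α_pos : 0 < α
  γ : S → ℝ
  γ_nonneg : ∀ x, 0 ≤ γ x
  γ_sum : ∑ x, γ x = 1

/-! ### The canonical path space -/

/-- Sequences `(θ₀, x₀), (θ₁, x₁), …` with `θ₀ = 0`, `x₀ ∈ S`, where for `k ≥ 1` either
`0 < θₖ < ∞` and `xₖ ∈ S`, or `θₖ = ∞` and `xₖ = x_∞` (`none`), the latter being absorbing. -/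
def pathSet (S : Type*) : Set (ℕ → ℝ≥0∞ × Option S) :=
  {e | (e 0).1 = 0 ∧ (e 0).2 ≠ none ∧
    ∀ k, 0 < (e (k + 1)).1 ∧ ((e (k + 1)).1 = ∞ ↔ (e (k + 1)).2 = none) ∧
      ((e k).2 = none → (e (k + 1)).2 = none)}

/-- The sample space `Ω`; its `σ`-algebra is the trace of the product `σ`-algebra. -/
abbrev Path (S : Type*) : Type _ := ↥(pathSet S)

section Paths

variable {S : Type*}

/-- The jump epochs `T_k = θ₁ + ⋯ + θ_k`. -/
noncomputable def jumpTime (e : Path S) (k : ℕ) : ℝ≥0∞ := ∑ i ∈ Finset.range (k + 1), (e.1 i).1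

/-- The post-jump states `X_k`. -/
def jumpState (e : Path S) (k : ℕ) : Option S := (e.1 k).2

open Classical in
/-- The left limit `ξ_{t-}`: it is `x₀` at `t = 0`, it is `x_k` for `T_k < t ≤ T_{k+1}`, and it is
`x_∞` for `t ≥ T_∞`. -/
noncomputable def stateLeft (e : Path S) (t : ℝ≥0) : Option S :=
  if t = 0 then jumpState e 0
  else if h : ∃ k, jumpTime e k < t ∧ t ≤ jumpTime e (k + 1) then jumpState e (Nat.find h)
  else none

open Classical in
/-- The random measure `μ*([0,s] × D) = #{k : T_k ≤ s, X_k ∈ D}`. -/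
noncomputable def jumpCount (s : ℝ≥0) (D : Set S) (e : Path S) : ℝ≥0∞ :=
  ∑' k, if jumpTime e k ≤ s ∧ jumpState e k ∈ some '' D then 1 else 0

/-- The internal history `𝓕_t`. -/
@[reducible] noncomputable def history [MeasurableSpace S] (t : ℝ≥0) : MeasurableSpace (Path S) :=
  ⨆ (s : ℝ≥0) (_ : s ≤ t) (D : Set S) (_ : MeasurableSet D),
    MeasurableSpace.comap (jumpCount s D) inferInstance

/-- The strict past `𝓕_{s-}`. -/
@[reducible] noncomputable def historyLeft [MeasurableSpace S] (s : ℝ≥0) : MeasurableSpace (Path S) :=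
  ⨆ (t : ℝ≥0) (_ : t < s), history t

/-- The predictable `σ`-algebra on `Ω × [0,∞)`. -/
@[reducible] noncomputable def predictable (S : Type*) [MeasurableSpace S] : MeasurableSpace (Path S × ℝ≥0) :=
  MeasurableSpace.generateFrom
    ({R | ∃ B : Set (Path S), MeasurableSet[history 0] B ∧ R = B ×ˢ {0}} ∪
     {R | ∃ (s : ℝ≥0) (C : Set (Path S)), 0 < s ∧ MeasurableSet[historyLeft s] C ∧
        R = C ×ˢ Ioi s})

end Paths

/-! ### Policies -/

section Policies

variable {S A : Type*} [Fintype S] {N : ℕ}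

/-- The admissible actions, with `A(x_∞) = {a_∞}`, as a subset of `A ∪ {a_∞}`. -/
def Model.admSet (M : Model S A N) : Option S → Set (Option A)
  | none => {none}
  | some x => some '' (M.Adm x : Set A)

/-- A (randomized, state-history dependent) policy: a transition probability from
`Ω × [0,∞)` with the predictable `σ`-algebra to `A ∪ {a_∞}`, concentrated on `A(ξ_{t-})`. -/
structure Policy [MeasurableSpace S] [MeasurableSpace A] (M : Model S A N) where
  toFun : Path S → ℝ≥0 → Measure (Option A)
  prob : ∀ e t, IsProbabilityMeasure (toFun e t)
  meas : ∀ G : Set (Option A), MeasurableSet G →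
    Measurable[predictable S] (fun p : Path S × ℝ≥0 => toFun p.1 p.2 G)
  adm : ∀ e t, toFun e t (M.admSet (stateLeft e t)) = 1

/-- `φ ∈ Π_s`: a stochastic kernel on the actions given the state with `φ(A(x) | x) = 1`. -/
def Model.IsStationaryKernel (M : Model S A N) (φ : (x : S) → M.Adm x → ℝ) : Prop :=
  ∀ x, (∀ a, 0 ≤ φ x a) ∧ ∑ a, φ x a = 1

/-- The policy `π` is the randomized stationary policy `φ`:
`π(da|e,t) = I{t < T_∞} φ(da|ξ_{t-}) + I{t ≥ T_∞} δ_{a_∞}(da)`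
(recall that `ξ_{t-} = x_∞` exactly when `t ≥ T_∞`). -/
def Policy.IsStationary [MeasurableSpace S] [MeasurableSpace A] {M : Model S A N}
    (π : Policy M) (φ : (x : S) → M.Adm x → ℝ) : Prop :=
  ∀ e t, π.toFun e t =
    match stateLeft e t with
    | none => Measure.dirac none
    | some x => ∑ a : M.Adm x, ENNReal.ofReal (φ x a) • Measure.dirac (some (a : A))

end Policies

/-- The density `m(t) exp(-∫₀ᵗ m)` and the remaining mass `exp(-∫₀^∞ m)` add up to one. -/
theorem survival_mass {m : ℝ → ℝ≥0∞} (hm : Measurable m) (C : ℝ≥0) (hC : ∀ t, m t ≤ C) :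
    (∫⁻ t in Ioi (0 : ℝ), m t * EReal.exp (-((∫⁻ v in Ioc 0 t, m v : ℝ≥0∞) : EReal))) +
      EReal.exp (-((∫⁻ v in Ioi (0 : ℝ), m v : ℝ≥0∞) : EReal)) = 1 := by
  set g : ℝ → ℝ := fun t => (m t).toReal with hg
  have hmt : ∀ t, m t ≠ ∞ := fun t => ne_top_of_le_ne_top (by simp) (hC t)
  have hgm : Measurable g := hm.ennreal_toReal
  have hg0 : ∀ t, 0 ≤ g t := fun t => ENNReal.toReal_nonneg
  have hgC : ∀ t, g t ≤ C := fun t => by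
    have := ENNReal.toReal_mono (by simp) (hC t); simpa using this
  have hmg : ∀ t, m t = ENNReal.ofReal (g t) := fun t => (ENNReal.ofReal_toReal (hmt t)).symm
  have hii : ∀ a b, IntervalIntegrable g volume a b := fun a b =>
    IntervalIntegrable.mono_fun (intervalIntegrable_const (c := (C : ℝ)))
      hgm.aestronglyMeasurable (ae_of_all _ fun t => by
        simpa [abs_of_nonneg (hg0 t)] using hgC t)
  set F : ℝ → ℝ := fun t => ∫ v in (0 : ℝ)..t, g v with hF
  have hF0 : ∀ t, 0 ≤ t → 0 ≤ F t := fun t ht =>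
    intervalIntegral.integral_nonneg ht fun v _ => hg0 v
  have hcum : ∀ t, 0 ≤ t → ∫⁻ v in Ioc 0 t, m v = ENNReal.ofReal (F t) := fun t ht => by
    rw [hF]; simp only
    rw [intervalIntegral.integral_of_le ht, ofReal_integral_eq_lintegral_ofReal]
    · simp [hmg]
    · exact (intervalIntegrable_iff_integrableOn_Ioc_of_le ht).1 (hii 0 t)
    · exact ae_of_all _ hg0
  have hS : ∀ t, 0 ≤ t → EReal.exp (-((∫⁻ v in Ioc 0 t, m v : ℝ≥0∞) : EReal))
      = ENNReal.ofReal (Real.exp (-F t)) := fun t ht => by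
    rw [hcum t ht, EReal.coe_ennreal_ofReal, max_eq_left (hF0 t ht), ← EReal.coe_neg,
      EReal.exp_coe]
  have hFlip : LipschitzWith C F := by
    refine LipschitzWith.of_dist_le_mul fun x y => ?_
    rw [Real.dist_eq, Real.dist_eq, hF]; simp only
    rw [intervalIntegral.integral_interval_sub_left (hii _ _) (hii _ _), ← Real.norm_eq_abs]
    exact intervalIntegral.norm_integral_le_of_norm_le_const fun t _ => by
      rw [Real.norm_of_nonneg (hg0 t)]; exact hgC t
  have hfin : ∀ T, 0 ≤ T →
      (∫⁻ t in Ioc 0 T, m t * EReal.exp (-((∫⁻ v in Ioc 0 t, m v : ℝ≥0∞) : EReal))) +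
      EReal.exp (-((∫⁻ v in Ioc 0 T, m v : ℝ≥0∞) : EReal)) = 1 := by
    intro T hT
    have hexp : LipschitzOnWith 1 Real.exp (Iic 0) :=
      Convex.lipschitzOnWith_of_nnnorm_deriv_le (fun x _ => Real.differentiableAt_exp)
        (fun x hx => by
          rw [Real.deriv_exp, ← NNReal.coe_le_coe, coe_nnnorm, Real.norm_eq_abs, Real.abs_exp]
          simpa using hx) (convex_Iic 0)
    have hac : AbsolutelyContinuousOnInterval (fun t => Real.exp (-F t)) 0 T := by
      have : LipschitzOnWith (1 * C) (Real.exp ∘ fun t => -F t) (uIcc 0 T) :=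
        hexp.comp hFlip.neg.lipschitzOnWith (fun t ht => by
          rw [uIcc_of_le hT] at ht
          simpa using hF0 t ht.1)
      exact this.absolutelyContinuousOnInterval
    have hder : ∀ᵐ t, HasDerivAt (fun t => Real.exp (-F t)) (Real.exp (-F t) * -g t) t := by
      have hloc : LocallyIntegrable g volume := by
        refine (locallyIntegrable_const (C : ℝ)).mono hgm.aestronglyMeasurable
          (ae_of_all _ fun t => ?_)
        simpa [abs_of_nonneg (hg0 t)] using hgC t
      filter_upwards [_root_.LocallyIntegrable.ae_hasDerivAt_integral hloc] with t ht
      exact (ht 0).neg.exp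
    have hint := hac.integral_deriv_eq_sub
    have h2 : ∫ t in (0 : ℝ)..T, deriv (fun t => Real.exp (-F t)) t =
        ∫ t in (0 : ℝ)..T, Real.exp (-F t) * -g t :=
      intervalIntegral.integral_congr_ae (hder.mono fun t ht _ => ht.deriv)
    rw [h2] at hint
    have hF00 : F 0 = 0 := by simp [hF]
    simp only [mul_neg, intervalIntegral.integral_neg, hF00, neg_zero, Real.exp_zero] at hint
    have h3 : ∫⁻ t in Ioc 0 T, m t * EReal.exp (-((∫⁻ v in Ioc 0 t, m v : ℝ≥0∞) : EReal))
        = ENNReal.ofReal (∫ t in (0 : ℝ)..T, Real.exp (-F t) * g t) := by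
      rw [intervalIntegral.integral_of_le hT, ofReal_integral_eq_lintegral_ofReal]
      · refine setLIntegral_congr_fun measurableSet_Ioc fun t ht => ?_
        rw [hS t ht.1.le, ENNReal.ofReal_mul (Real.exp_pos _).le, ← hmg, mul_comm]
      · refine Measure.integrableOn_of_bounded (M := C) (by simp) ?_ ?_
        · exact ((Real.continuous_exp.comp hFlip.continuous.neg).measurable.mul
            hgm).aestronglyMeasurable
        · refine (ae_restrict_iff' measurableSet_Ioc).2 (ae_of_all _ fun t ht => ?_)
          rw [Real.norm_of_nonneg (mul_nonneg (Real.exp_pos _).le (hg0 t))]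
          have : Real.exp (-F t) ≤ 1 := Real.exp_le_one_iff.2 (by simpa using hF0 t ht.1.le)
          nlinarith [hg0 t, hgC t]
      · exact ae_of_all _ fun t => mul_nonneg (Real.exp_pos _).le (hg0 t)
    rw [h3, hS T hT, ← ENNReal.ofReal_add _ (Real.exp_pos _).le, ← ENNReal.ofReal_one]
    · congr 1; linarith
    · exact intervalIntegral.integral_nonneg hT fun t _ =>
        mul_nonneg (Real.exp_pos _).le (hg0 t)
  have hlim : ∀ f : ℝ → ℝ≥0∞, Filter.Tendsto (fun n : ℕ => ∫⁻ t in Ioc (0 : ℝ) n, f t) Filter.atTop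
      (nhds (∫⁻ t in Ioi (0 : ℝ), f t)) := fun f => by
    have hU : Ioi (0 : ℝ) = ⋃ n : ℕ, Ioc (0 : ℝ) n := by
      ext t; simp only [mem_Ioi, mem_iUnion, mem_Ioc]
      exact ⟨fun h => (exists_nat_ge t).imp fun n hn => ⟨h, hn⟩, fun ⟨_, h, _⟩ => h⟩
    have hmono : Monotone fun n : ℕ => Ioc (0 : ℝ) n := fun a b hab =>
      Ioc_subset_Ioc_right (by exact_mod_cast hab)
    rw [hU, setLIntegral_iUnion_of_directed _ hmono.directed_le]
    exact tendsto_atTop_iSup fun a b hab => lintegral_mono_set (hmono hab)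
  refine tendsto_nhds_unique (f := fun _ : ℕ => (1 : ℝ≥0∞)) (l := Filter.atTop) ?_
    tendsto_const_nhds
  have hA := (hlim fun t => m t * EReal.exp (-((∫⁻ v in Ioc 0 t, m v : ℝ≥0∞) : EReal)))
  have hB : Filter.Tendsto (fun n : ℕ => EReal.exp (-((∫⁻ v in Ioc (0 : ℝ) n, m v : ℝ≥0∞) : EReal)))
      Filter.atTop (nhds (EReal.exp (-((∫⁻ v in Ioi (0 : ℝ), m v : ℝ≥0∞) : EReal)))) :=
    ((ENNReal.continuous_exp.comp (continuous_neg.comp continuous_coe_ennreal_ereal)).tendsto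
      _).comp (hlim m)
  exact (hA.add hB).congr fun n => hfin n n.cast_nonneg

/-! ### Measurability of the path functionals -/

section Measurability

variable {S : Type*} [MeasurableSpace S]

theorem measurable_jumpTime (k : ℕ) : Measurable fun e : Path S => jumpTime e k := by
  unfold jumpTime
  exact Finset.measurable_sum _ fun i _ =>
    measurable_fst.comp ((measurable_pi_apply i).comp measurable_subtype_coe)

theorem measurable_jumpState (k : ℕ) : Measurable fun e : Path S => jumpState e k :=
  measurable_snd.comp ((measurable_pi_apply k).comp measurable_subtype_coe)

theorem measurable_jumpCount (s : ℝ≥0) {D : Set S} (hD : MeasurableSet D) :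
    Measurable (jumpCount s D) := by
  classical
  unfold jumpCount
  refine Measurable.tsum fun k => Measurable.ite ?_ measurable_const measurable_const
  have hD' : MeasurableSet (some '' D : Set (Option S)) := by
    rw [Option.measurableSet_iff_isolated]
    simpa [preimage_image_eq _ (Option.some_injective S)] using hD
  exact (measurableSet_le (measurable_jumpTime k) measurable_const).inter
    (measurable_jumpState k hD')

theorem history_le (t : ℝ≥0) : history t ≤ (inferInstance : MeasurableSpace (Path S)) :=
  iSup₂_le fun s _ => iSup₂_le fun _ hD => (measurable_jumpCount s hD).comap_le

theorem historyLeft_le (s : ℝ≥0) : historyLeft s ≤ (inferInstance : MeasurableSpace (Path S)) :=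
  iSup₂_le fun t _ => history_le t

theorem predictable_le :
    predictable S ≤ (inferInstance : MeasurableSpace (Path S × ℝ≥0)) := by
  refine MeasurableSpace.generateFrom_le ?_
  rintro R (⟨B, hB, rfl⟩ | ⟨s, C, -, hC, rfl⟩)
  · exact (history_le 0 _ hB).prod (measurableSet_singleton 0)
  · exact (historyLeft_le s _ hC).prod measurableSet_Ioi

theorem measurableSet_pathSet [MeasurableSingletonClass S] : MeasurableSet (pathSet S) := by
  have h1 : ∀ k, Measurable fun e : ℕ → ℝ≥0∞ × Option S => (e k).1 :=
    fun k => measurable_fst.comp (measurable_pi_apply k)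
  have h2 : ∀ k, MeasurableSet {e : ℕ → ℝ≥0∞ × Option S | (e k).2 = none} :=
    fun k => (measurable_snd.comp (measurable_pi_apply k)) (measurableSet_singleton none)
  have h3 : ∀ (k : ℕ) (a : ℝ≥0∞), MeasurableSet {e : ℕ → ℝ≥0∞ × Option S | (e k).1 = a} :=
    fun k a => h1 k (measurableSet_singleton a)
  have h4 : ∀ k, MeasurableSet {e : ℕ → ℝ≥0∞ × Option S | 0 < (e (k + 1)).1 ∧
      ((e (k + 1)).1 = ∞ ↔ (e (k + 1)).2 = none) ∧ ((e k).2 = none → (e (k + 1)).2 = none)} :=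
    fun k => (measurableSet_lt measurable_const (h1 (k + 1))).inter
      ((MeasurableSet.iff (h3 (k + 1) ∞) (h2 (k + 1))).inter
        (MeasurableSet.imp (h2 k) (h2 (k + 1))))
  convert! (h3 0 0).inter ((h2 0).compl.inter (MeasurableSet.iInter h4)) using 1
  ext e
  simp [pathSet]

end Measurability

/-! ### The law of the controlled process -/

section Law

variable {S A : Type*} [Fintype S] [MeasurableSpace S] [MeasurableSingletonClass S]
  [MeasurableSpace A] [MeasurableSingletonClass A] {N : ℕ} {M : Model S A N}

/-- The prefixes `(θ₀, x₀), …, (θ_k, x_k)`. -/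
abbrev Prefix (S : Type*) (k : ℕ) : Type _ := (i : Finset.Iic k) → ℝ≥0∞ × Option S

/-- The prefix `h` followed by `(∞, x_∞), (∞, x_∞), …`. -/
def pad {S : Type*} {k : ℕ} (h : Prefix S k) : ℕ → ℝ≥0∞ × Option S :=
  fun i => if hi : i ∈ Finset.Iic k then h ⟨i, hi⟩ else (∞, none)

open Classical in
/-- For a path `e` with no jump after the `k`-th one, the intensity at time `T_k + t`
of a jump to `y`, i.e. `m_k({y} | h_k, t) = ∫ π(da | e, T_k + t) q({y} | x_k, a) I{y ≠ x_k}`.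
As `π` is predictable, this depends on `h_k` and `t > 0` only. -/
noncomputable def jumpRate (π : Policy M) (k : ℕ) (e : Path S) (y : S) (t : ℝ) : ℝ≥0∞ :=
  match jumpState e k with
  | none => 0
  | some x => if y = x then 0 else
      ∑ a : M.Adm x, π.toFun e ((jumpTime e k).toNNReal + t.toNNReal) {some (a : A)} *
        ENNReal.ofReal (M.q x a y)

/-- The conditional law of `(θ_{k+1}, x_{k+1})` given the `k`-component history of `e`:
it is `m_k(dx | h_k, t) exp(-∫₀ᵗ m_k(S | h_k, v) dv) dt` on `(0,∞) × S` and has mass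
`exp(-∫₀^∞ m_k(S | h_k, v) dv)` at `(∞, x_∞)`.  It is `δ_(∞, x_∞)` if `x_k = x_∞`. -/
noncomputable def sojournLaw (π : Policy M) (k : ℕ) (e : Path S) :
    Measure (ℝ≥0∞ × Option S) :=
  (∑ y : S, ((volume.restrict (Ioi (0 : ℝ))).withDensity fun t =>
      jumpRate π k e y t *
        EReal.exp (-((∫⁻ v in Ioc 0 t, ∑ z, jumpRate π k e z v : ℝ≥0∞) : EReal))).map
      fun t => (ENNReal.ofReal t, some y)) +
  EReal.exp (-((∫⁻ v in Ioi (0 : ℝ), ∑ z, jumpRate π k e z v : ℝ≥0∞) : EReal)) •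
    Measure.dirac (∞, none)

theorem exists_jumpRate_le (π : Policy M) (k : ℕ) (e : Path S) :
    ∃ C : ℝ≥0, ∀ t, ∑ z, jumpRate π k e z t ≤ C := by
  cases hs : jumpState e k with
  | none => exact ⟨0, fun t => by simp [jumpRate, hs]⟩
  | some x =>
    refine ⟨∑ z, ∑ a : M.Adm x, (M.q x a z).toNNReal, fun t => ?_⟩
    push_cast
    refine Finset.sum_le_sum fun z _ => ?_
    simp only [jumpRate, hs]
    split_ifs
    · exact zero_le
    · refine Finset.sum_le_sum fun a _ => ?_
      have := π.prob e ((jumpTime e k).toNNReal + t.toNNReal)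
      calc _ ≤ 1 * ENNReal.ofReal (M.q x a z) := by gcongr; exact prob_le_one
        _ = _ := by rw [one_mul]; rfl

theorem measurable_jumpRate (π : Policy M) (k : ℕ) (y : S) :
    Measurable fun p : Path S × ℝ => jumpRate π k p.1 y p.2 := by
  classical
  have h : (fun p : Path S × ℝ => jumpRate π k p.1 y p.2) = fun p =>
      ∑ x : S, if jumpState p.1 k = some x then (if y = x then 0 else
        ∑ a : M.Adm x, π.toFun p.1 ((jumpTime p.1 k).toNNReal + p.2.toNNReal) {some (a : A)} *
          ENNReal.ofReal (M.q x a y)) else 0 := by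
    funext p
    unfold jumpRate
    cases hs : jumpState p.1 k with
    | none => simp
    | some x =>
      rw [Finset.sum_eq_single x]
      · simp
      · intro b _ hb; rw [if_neg]; simpa using fun h => hb h.symm
      · simp
  rw [h]
  refine Finset.measurable_sum _ fun x _ => Measurable.ite ?_ ?_ measurable_const
  · exact ((measurable_jumpState k).comp measurable_fst) (measurableSet_singleton (some x))
  · by_cases hy : y = x
    · simp [hy]
    · simp only [hy, if_false]
      refine Finset.measurable_sum _ fun a _ => Measurable.mul_const ?_ _
      have hm := (π.meas {some (a : A)} (measurableSet_singleton _)).mono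
        predictable_le le_rfl
      exact hm.comp (measurable_fst.prodMk
        ((((measurable_jumpTime k).comp measurable_fst).ennreal_toNNReal).add
          measurable_snd.real_toNNReal))

theorem measurable_survival (π : Policy M) (k : ℕ) :
    Measurable fun p : Path S × ℝ =>
      EReal.exp (-((∫⁻ v in Ioc 0 p.2, ∑ z, jumpRate π k p.1 z v : ℝ≥0∞) : EReal)) := by
  refine EReal.measurable_exp.comp (Measurable.neg (measurable_coe_ennreal_ereal.comp ?_))
  have h : (fun p : Path S × ℝ => ∫⁻ v in Ioc 0 p.2, ∑ z, jumpRate π k p.1 z v) =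
      fun p => ∫⁻ v, {w : (Path S × ℝ) × ℝ | 0 < w.2 ∧ w.2 ≤ w.1.2}.indicator
        (fun w => ∑ z, jumpRate π k w.1.1 z w.2) (p, v) := by
    funext p
    rw [← lintegral_indicator measurableSet_Ioc]
    rfl
  rw [h]
  refine Measurable.lintegral_prod_right' (Measurable.indicator ?_ ?_)
  · exact Finset.measurable_sum _ fun z _ => (measurable_jumpRate π k z).comp
      ((measurable_fst.comp measurable_fst).prodMk measurable_snd)
  · exact (measurableSet_lt measurable_const measurable_snd).inter
      (measurableSet_le measurable_snd (measurable_snd.comp measurable_fst))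

theorem measurable_sojournLaw (π : Policy M) (k : ℕ) : Measurable (sojournLaw π k) := by
  refine Measure.measurable_of_measurable_coe _ fun B hB => ?_
  have hmap : ∀ y : S, Measurable fun t : ℝ => (ENNReal.ofReal t, some y) := fun y =>
    ENNReal.measurable_ofReal.prodMk measurable_const
  simp only [sojournLaw, Measure.add_apply, Measure.finsetSum_apply, Measure.smul_apply,
    smul_eq_mul]
  refine Measurable.add (Finset.measurable_sum _ fun y _ => ?_) (Measurable.mul_const ?_ _)
  · simp_rw [Measure.map_apply (hmap y) hB, withDensity_apply _ (hmap y hB)]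
    exact Measurable.lintegral_prod_right'
      (f := fun p : Path S × ℝ => jumpRate π k p.1 y p.2 *
        EReal.exp (-((∫⁻ v in Ioc 0 p.2, ∑ z, jumpRate π k p.1 z v : ℝ≥0∞) : EReal)))
      ((measurable_jumpRate π k y).mul (measurable_survival π k))
  · refine EReal.measurable_exp.comp (Measurable.neg (measurable_coe_ennreal_ereal.comp ?_))
    exact Measurable.lintegral_prod_right'
      (f := fun p : Path S × ℝ => ∑ z, jumpRate π k p.1 z p.2)
      (Finset.measurable_sum _ fun z _ => measurable_jumpRate π k z)

theorem isProbabilityMeasure_sojournLaw (π : Policy M) (k : ℕ) (e : Path S) :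
    IsProbabilityMeasure (sojournLaw π k e) := by
  have hmap : ∀ y : S, Measurable fun t : ℝ => (ENNReal.ofReal t, some y) := fun y =>
    ENNReal.measurable_ofReal.prodMk measurable_const
  have hr : ∀ z, Measurable (jumpRate π k e z) := fun z =>
    (measurable_jumpRate π k z).comp measurable_prodMk_left
  have hv : Measurable fun t : ℝ =>
      EReal.exp (-((∫⁻ v in Ioc 0 t, ∑ z, jumpRate π k e z v : ℝ≥0∞) : EReal)) :=
    (measurable_survival π k).comp (measurable_prodMk_left (x := e))
  obtain ⟨C, hC⟩ := exists_jumpRate_le π k e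
  constructor
  simp only [sojournLaw, Measure.add_apply, Measure.finsetSum_apply, Measure.smul_apply,
    smul_eq_mul, measure_univ, mul_one]
  simp_rw [Measure.map_apply (hmap _) MeasurableSet.univ, preimage_univ,
    withDensity_apply _ MeasurableSet.univ, Measure.restrict_univ]
  rw [← lintegral_finsetSum Finset.univ (f := fun y t => jumpRate π k e y t *
    EReal.exp (-((∫⁻ v in Ioc 0 t, ∑ z, jumpRate π k e z v : ℝ≥0∞) : EReal)))
    fun y _ => (hr y).mul hv]
  simp_rw [← Finset.sum_mul]
  exact survival_mass (Finset.measurable_sum _ fun z _ => hr z) C hC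

open Classical in
/-- The transition law of the sequence `(θ_k, x_k)` under the policy `π`.  Its value at prefixes
which do not extend to a path is immaterial. -/
noncomputable def stepKernel (π : Policy M) (k : ℕ) :
    Kernel (Prefix S k) (ℝ≥0∞ × Option S) where
  toFun h := if hh : pad h ∈ pathSet S then sojournLaw π k ⟨pad h, hh⟩
    else Measure.dirac (∞, none)
  measurable' := by
    have hp : Measurable (pad : Prefix S k → ℕ → ℝ≥0∞ × Option S) := by
      refine measurable_pi_lambda _ fun i => ?_
      unfold pad
      by_cases hi : i ∈ Finset.Iic k
      · simp only [hi, dif_pos]; exact measurable_pi_apply _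
      · simp only [hi]; exact measurable_const
    refine Measurable.dite (s := pad ⁻¹' pathSet S)
      (f := fun h => sojournLaw π k ⟨pad h.1, h.2⟩) (g := fun _ => Measure.dirac (∞, none))
      ?_ measurable_const (hp measurableSet_pathSet)
    exact (measurable_sojournLaw π k).comp ((hp.comp measurable_subtype_coe).subtype_mk)

instance (π : Policy M) (k : ℕ) : IsMarkovKernel (stepKernel π k) := by
  classical
  refine ⟨fun h => ?_⟩
  change IsProbabilityMeasure (if hh : pad h ∈ pathSet S then sojournLaw π k ⟨pad h, hh⟩
    else Measure.dirac (∞, none))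
  split_ifs with hh
  · exact isProbabilityMeasure_sojournLaw π k _
  · infer_instance

/-- The law `P_x^π` on the path space, for the initial state `x`, given by the
Ionescu-Tulcea theorem. -/
noncomputable def law (π : Policy M) (x : S) : Measure (Path S) :=
  (Kernel.traj (X := fun _ => ℝ≥0∞ × Option S) (stepKernel π) 0
    fun _ => (0, some x)).comap Subtype.val

/-! ### The discounted criteria -/

/-- `V_α(x, π, u) = ∫₀^∞ e^{-αt} E_x^π [∫ u(ξ_{t-}, a) π(da | e, t)] dt`. -/
noncomputable def discountedFrom (π : Policy M) (u : (x : S) → M.Adm x → ℝ) (x : S) : ℝ :=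
  ∫ t in Ioi (0 : ℝ), Real.exp (-M.α * t) *
    ∫ e, (match stateLeft e t.toNNReal with
      | none => 0
      | some z => ∑ a : M.Adm z, u z a * (π.toFun e t.toNNReal).real {some (a : A)}) ∂(law π x)

/-- `V_α(π, u) = ∫ V_α(x, π, u) γ(dx)`. -/
noncomputable def discounted (π : Policy M) (u : (x : S) → M.Adm x → ℝ) : ℝ :=
  ∑ x, M.γ x * discountedFrom π u x

/-- The set `U` of policies satisfying the constraints `V_n(π) ≤ d_n`. -/
def feasiblePolicies (M : Model S A N) : Set (Policy M) :=
  {π | ∀ n, discounted π (M.c n) ≤ M.d n}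

/-- `π ∈ U` attains `sup_{U} V_r`. -/
def IsConstrainedOptimal (π : Policy M) : Prop :=
  π ∈ feasiblePolicies M ∧
    IsLUB ((fun π' => discounted π' M.r) '' feasiblePolicies M) (discounted π M.r)

end Law

/-! ### The finite linear program -/

section LinearProgram

variable {S A : Type*} [Fintype S] {N : ℕ}

/-- The set `K` of admissible state-action pairs. -/
abbrev Model.K (M : Model S A N) : Type _ := (x : S) × M.Adm x

open Classical in
/-- Feasible points of the finite linear program. -/
structure Model.LPFeasible (M : Model S A N) (η : M.K → ℝ) : Prop where
  cost : ∀ n, ∑ x, ∑ a, M.c n x a * η ⟨x, a⟩ ≤ M.α * M.d n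
  balance : ∀ x, M.α * ∑ a, η ⟨x, a⟩ = M.α * M.γ x + ∑ y, ∑ a, M.q y a x * η ⟨y, a⟩
  nonneg : ∀ k, 0 ≤ η k

/-- The objective of the linear program (with `c₀ = -r`), to be minimized. -/
noncomputable def Model.LPObjective (M : Model S A N) (η : M.K → ℝ) : ℝ :=
  ∑ x, ∑ a, 1 / M.α * (-M.r x a) * η ⟨x, a⟩

def Model.LPOptimal (M : Model S A N) (η : M.K → ℝ) : Prop :=
  M.LPFeasible η ∧ ∀ η', M.LPFeasible η' → M.LPObjective η ≤ M.LPObjective η'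

open Classical in
/-- The columns of the linear program in standard form, with one slack variable per cost
constraint: the rows are the `N` cost constraints
`∑ c_n η + s_n = α d_n` and the balance equations
`α ∑_a η(y,a) - ∑ q(y|x,a) η(x,a) = α γ(y)`, the columns are the pairs in `K` and the slacks. -/
noncomputable def Model.column (M : Model S A N) : M.K ⊕ Fin N → (Fin N ⊕ S → ℝ)
  | .inl k => Sum.elim (fun n => M.c n k.1 k.2)
      (fun y => (if k.1 = y then M.α else 0) - M.q k.1 k.2 y)
  | .inr n => Pi.single (Sum.inl n) 1

/-- The variables of the standard form at `η`: the entries of `η` and the slacks. -/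
noncomputable def Model.standardPoint (M : Model S A N) (η : M.K → ℝ) : M.K ⊕ Fin N → ℝ :=
  Sum.elim η fun n => M.α * M.d n - ∑ x, ∑ a, M.c n x a * η ⟨x, a⟩

/-- `η` is a basic feasible solution: it is feasible, and there is a set `B` of (basic) variables
whose columns form a basis of the column space such that all other variables vanish. -/
def Model.LPBasic (M : Model S A N) (η : M.K → ℝ) : Prop :=
  M.LPFeasible η ∧ ∃ B : Set (M.K ⊕ Fin N),
    LinearIndepOn ℝ M.column B ∧
    Submodule.span ℝ (M.column '' B) = Submodule.span ℝ (range M.column) ∧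
    ∀ j ∉ B, M.standardPoint η j = 0

/-- The marginal of `η` on `S`. -/
noncomputable def Model.marginal (M : Model S A N) (η : M.K → ℝ) (x : S) : ℝ := ∑ a, η ⟨x, a⟩

open Classical in
/-- The stationary policy `φ^η`, with the choice `sel x` of an action at states of zero mass. -/
noncomputable def Model.policyOf (M : Model S A N) (η : M.K → ℝ) (sel : (x : S) → M.Adm x)
    (x : S) (a : M.Adm x) : ℝ :=
  if 0 < M.marginal η x then η ⟨x, a⟩ / M.marginal η x else if a = sel x then 1 else 0

open Classical in
/-- The number of randomizations `#(φ) = ∑_x m(x, φ)`, where `m(x, φ) + 1` is the number of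
actions `a ∈ A(x)` with `φ(a | x) > 0`. -/
noncomputable def Model.randomizations (M : Model S A N) (φ : (x : S) → M.Adm x → ℝ) : ℕ :=
  ∑ x, ((Finset.univ.filter fun a => 0 < φ x a).card - 1)

end LinearProgram

end CTMDP

set_option linter.unusedSectionVars false

/-! The proof identifies policies with feasible points of the linear program through discounted
occupation measures. For a policy `π`, `occupation π` gives each pair `(x, a)` the quantity `α`
times the expected discounted time spent using `a` at `x`, averaged over the initial law. Every
criterion is linear in it: `α V(π, u) = ∑ u · occupation π` (`discounted_eq_occupation`).

Every occupation measure satisfies the balance equations (`occ_balance`). Between consecutive jump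
times `α ∫ e^{-αt} dt = e^{-αT_k} - e^{-αT_{k+1}}`, so `α` times the time spent at `x`, plus the
discounted flow out of `x`, equals the initial mass plus the discounted flow into `x`. The flows are
computed from the rates by integrating against the conditional law of the next jump
(`lintegral_sum_sojournOcc_mul_rate`); predictability enters here, since until the next jump the
policy sees only the past. The sum over jumps telescopes in `ℝ≥0∞`, so explosion never has to be
excluded: after `T_∞` nothing is collected. Hence every feasible policy gives a feasible point with
objective `-V(π, r)`.

Conversely, a stationary policy splits the time spent at each state according to `φ`, so its
occupation measure is determined by the state marginal, which solves a linear system with matrix `α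
- Qᵀ`. This matrix is injective (`eq_zero_of_discounted_stationary`). For `φ = policyOf η sel` the
marginal of `η` solves the same system, so the occupation measure is `η` itself
(`LPFeasible.occupation_eq`). Optimality of `η` therefore transfers to the policy, against all
history-dependent competitors.

The bound on randomizations is a rank count (`LPBasic.card_pos_le`). The columns of the positive
entries of a basic solution are independent, and they vanish in the balance rows of the states of
zero mass. So there are at most `N` more positive entries than states of positive mass, and this
excess is the number of randomizations. -/

namespace CTMDP

/-! ### The linear program: injectivity of the balance system and the rank bound for basic
solutions. -/

section LinearProgramming

variable {S A : Type*} [Fintype S] {N : ℕ} {M : Model S A N}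

/-- A vector annihilated by `α - Qᵀ`, for a conservative rate matrix `Q` and `α > 0`, is zero. -/
theorem eq_zero_of_discounted_stationary {Q : S → S → ℝ} (hQ : ∀ y x, x ≠ y → 0 ≤ Q y x)
    (hsum : ∀ y, ∑ x, Q y x = 0) {α : ℝ} (hα : 0 < α) {v : S → ℝ}
    (hv : ∀ x, α * v x = ∑ y, Q y x * v y) : v = 0 := by
  classical
  -- Moving the diagonal term to the left gives the nonnegative coefficient `α - Q x x`, and only
  -- nonnegative rates remain on the right, so the triangle inequality preserves the equation as an
  -- inequality for `|v|`.
  have hx : ∀ x, α * |v x| ≤ ∑ y, Q y x * |v y| := by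
    intro x
    have h1 : (α - Q x x) * v x = ∑ y ∈ Finset.univ.erase x, Q y x * v y := by
      have := Finset.add_sum_erase Finset.univ (fun y => Q y x * v y) (Finset.mem_univ x)
      have h2 := hv x
      linarith
    have hxx : Q x x ≤ 0 := by
      have := Finset.add_sum_erase Finset.univ (fun y => Q x y) (Finset.mem_univ x)
      have h2 : 0 ≤ ∑ y ∈ Finset.univ.erase x, Q x y :=
        Finset.sum_nonneg fun y hy => hQ x y (Finset.ne_of_mem_erase hy)
      have h3 := hsum x
      linarith
    have h4 : (α - Q x x) * |v x| ≤ ∑ y ∈ Finset.univ.erase x, Q y x * |v y| := by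
      rw [← abs_of_nonneg (by linarith : 0 ≤ α - Q x x), ← abs_mul, h1]
      refine (Finset.abs_sum_le_sum_abs _ _).trans (Finset.sum_le_sum fun y hy => ?_)
      rw [abs_mul, abs_of_nonneg (hQ y x (Finset.ne_of_mem_erase hy).symm)]
    have := Finset.add_sum_erase Finset.univ (fun y => Q y x * |v y|) (Finset.mem_univ x)
    linarith
  -- Summing over `x` annihilates the right side, because each row of `Q` sums to zero.
  have hle : α * ∑ x, |v x| ≤ 0 := by
    rw [Finset.mul_sum]
    refine (Finset.sum_le_sum fun x _ => hx x).trans_eq ?_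
    rw [Finset.sum_comm]
    simp [← Finset.sum_mul, hsum]
  have h0 : ∑ x, |v x| ≤ 0 := by
    by_contra! h
    have := mul_pos hα h
    linarith
  funext x
  have hz := (Finset.sum_eq_zero_iff_of_nonneg fun x _ => abs_nonneg (v x)).1
    (le_antisymm h0 (Finset.sum_nonneg fun x _ => abs_nonneg (v x)))
  simpa using hz x (Finset.mem_univ x)

theorem Model.LPFeasible.marginal_nonneg {η : M.K → ℝ} (hη : M.LPFeasible η) (x : S) :
    0 ≤ M.marginal η x :=
  Finset.sum_nonneg fun a _ => hη.nonneg ⟨x, a⟩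

theorem Model.LPFeasible.eq_zero_of_marginal {η : M.K → ℝ} (hη : M.LPFeasible η) {x : S}
    (hx : ¬ 0 < M.marginal η x) (a : M.Adm x) : η ⟨x, a⟩ = 0 := by
  have h0 : ∑ a, η ⟨x, a⟩ = 0 := le_antisymm (not_lt.1 hx) (hη.marginal_nonneg x)
  exact (Finset.sum_eq_zero_iff_of_nonneg fun a _ => hη.nonneg ⟨x, a⟩).1 h0 a (Finset.mem_univ a)

/-- The disintegration of `η` holds for any choice `sel`: at a state of zero mass both sides vanish.
-/
theorem Model.LPFeasible.policyOf_mul_marginal {η : M.K → ℝ} (hη : M.LPFeasible η)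
    (sel : (x : S) → M.Adm x) (x : S) (a : M.Adm x) :
    M.policyOf η sel x a * M.marginal η x = η ⟨x, a⟩ := by
  unfold Model.policyOf
  by_cases hx : 0 < M.marginal η x
  · rw [if_pos hx, div_mul_cancel₀ _ hx.ne']
  · rw [hη.eq_zero_of_marginal hx a, le_antisymm (not_lt.1 hx) (hη.marginal_nonneg x), mul_zero]

theorem Model.LPFeasible.isStationaryKernel {η : M.K → ℝ} (hη : M.LPFeasible η)
    (sel : (x : S) → M.Adm x) : M.IsStationaryKernel (M.policyOf η sel) := by
  intro x
  unfold Model.policyOf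
  by_cases hx : 0 < M.marginal η x
  · simp only [if_pos hx]
    refine ⟨fun a => div_nonneg (hη.nonneg _) hx.le, ?_⟩
    rw [← Finset.sum_div]
    exact div_self hx.ne'
  · simp only [if_neg hx]
    exact ⟨fun a => by split_ifs <;> norm_num, by simp⟩

/-- Under a feasible point of the linear program no mass flows into a state of zero mass. -/
theorem Model.LPFeasible.q_eq_zero {η : M.K → ℝ} (hη : M.LPFeasible η) {x : S}
    (hx : ¬ 0 < M.marginal η x) {k : M.K} (hk : 0 < η k) : M.q k.1 k.2 x = 0 := by
  -- The only rate that may be negative is the diagonal one, and it is multiplied by an entry of `η`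
  -- at the massless state `x`. The balance equation at `x` then makes a sum of nonnegative terms at
  -- most zero.
  have hterm : ∀ y a, 0 ≤ M.q y a x * η ⟨y, a⟩ := by
    intro y a
    by_cases hy : x = y
    · subst hy; simp [hη.eq_zero_of_marginal hx a]
    · exact mul_nonneg (M.q_nonneg y a x hy) (hη.nonneg _)
  have hb := hη.balance x
  have h0 : ∑ a, η ⟨x, a⟩ = 0 := le_antisymm (not_lt.1 hx) (hη.marginal_nonneg x)
  have hin : ∀ y ∈ Finset.univ, 0 ≤ ∑ a, M.q y a x * η ⟨y, a⟩ :=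
    fun y _ => Finset.sum_nonneg fun a _ => hterm y a
  have hz : ∑ y, ∑ a, M.q y a x * η ⟨y, a⟩ = 0 := by
    refine le_antisymm ?_ (Finset.sum_nonneg hin)
    have := mul_nonneg M.α_pos.le (M.γ_nonneg x)
    rw [h0, mul_zero] at hb
    linarith
  have h1 := (Finset.sum_eq_zero_iff_of_nonneg hin).1 hz k.1 (Finset.mem_univ _)
  have h2 := (Finset.sum_eq_zero_iff_of_nonneg fun a _ => hterm k.1 a).1 h1 k.2
    (Finset.mem_univ _)
  exact (mul_eq_zero.1 h2).resolve_right hk.ne'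

open Classical in
/-- A basic solution has at most `N` more positive entries than there are states of positive
mass. -/
theorem Model.LPBasic.card_pos_le {η : M.K → ℝ} (hb : M.LPBasic η) :
    (Finset.univ.filter fun k : M.K => 0 < η k).card ≤
      N + (Finset.univ.filter fun x : S => 0 < M.marginal η x).card := by
  obtain ⟨hη, B, hB, -, hz⟩ := hb
  -- `T` indexes the rows that survive: all cost rows and the balance rows of states of positive
  -- mass.
  let T := Fin N ⊕ {x : S // 0 < M.marginal η x}
  let ι : T → Fin N ⊕ S := Sum.map id Subtype.val
  have hι : Function.Injective ι := Function.Injective.sumMap Function.injective_id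
    Subtype.val_injective
  let L := Function.ExtendByZero.linearMap ℝ ι
  let P := {k : M.K // 0 < η k}
  have hcol : LinearIndependent ℝ fun k : P => M.column (Sum.inl k.1) := by
    let f : P → B := fun k => ⟨Sum.inl k.1, by
      by_contra h
      exact k.2.ne' (hz _ h)⟩
    have hf : Function.Injective f := by
      intro k l h
      exact Subtype.ext (Sum.inl_injective (congrArg Subtype.val h))
    exact (LinearIndependent.comp hB f hf)
  -- In the balance row of a massless state, the column of a positive entry `k` has no `α` term,
  -- since `k` sits at another state, and no rate term by `LPFeasible.q_eq_zero`. So these columns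
  -- are extensions by zero of vectors indexed by `T`, and independence descends to a space of
  -- dimension `card T`.
  have hfac : (fun k : P => M.column (Sum.inl k.1)) =
      L ∘ fun k : P => M.column (Sum.inl k.1) ∘ ι := by
    funext k j
    by_cases hj : ∃ t, ι t = j
    · obtain ⟨t, rfl⟩ := hj
      exact (hι.extend_apply (M.column (Sum.inl k.1) ∘ ι) 0 t).symm
    · have hR : (L (M.column (Sum.inl k.1) ∘ ι)) j = 0 :=
        Function.extend_apply' _ _ j hj
      rw [Function.comp_apply, hR]
      cases j with
      | inl n => exact absurd ⟨Sum.inl n, rfl⟩ hj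
      | inr x =>
        have hx : ¬ 0 < M.marginal η x := fun h => hj ⟨Sum.inr ⟨x, h⟩, rfl⟩
        have hne : k.1.1 ≠ x := by
          rintro rfl
          exact k.2.ne' (hη.eq_zero_of_marginal hx k.1.2)
        simp [Model.column, hne, hη.q_eq_zero hx k.2]
  rw [hfac] at hcol
  have hcard := (LinearIndependent.of_comp L hcol).fintype_card_le_finrank
  simp only [Module.finrank_fintype_fun_eq_card, T, P, Fintype.card_sum, Fintype.card_fin,
    Fintype.card_subtype] at hcard
  exact hcard

/-- At a state of positive mass, `φ` and `η` have the same support, so the randomizations there are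
its size minus one. At a massless state `φ` is deterministic and `η` has no support. Summation over
states turns `card_pos_le` into the bound. -/
theorem Model.LPBasic.randomizations_le {η : M.K → ℝ} (hb : M.LPBasic η)
    (sel : (x : S) → M.Adm x) : M.randomizations (M.policyOf η sel) ≤ N := by
  classical
  have hη := hb.1
  have hcard := hb.card_pos_le
  have hx : ∀ x, (Finset.univ.filter fun a => 0 < M.policyOf η sel x a).card - 1 +
      (if 0 < M.marginal η x then 1 else 0) =
        (Finset.univ.filter fun a : M.Adm x => 0 < η ⟨x, a⟩).card := by
    intro x
    by_cases h : 0 < M.marginal η x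
    · have hiff : ∀ a, 0 < M.policyOf η sel x a ↔ 0 < η ⟨x, a⟩ := fun a => by
        simp [Model.policyOf, h, div_pos_iff_of_pos_right]
      simp only [hiff, if_pos h]
      refine Nat.sub_add_cancel (Finset.card_pos.2 ?_)
      obtain ⟨a, -, ha⟩ := Finset.exists_lt_of_sum_lt (s := Finset.univ)
        (f := fun _ : M.Adm x => (0 : ℝ)) (g := fun a => η ⟨x, a⟩)
        (by simpa [Model.marginal] using h)
      exact ⟨a, by simpa using ha⟩
    · have hiff : ∀ a, 0 < M.policyOf η sel x a ↔ a = sel x := fun a => by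
        rw [Model.policyOf, if_neg h]
        split_ifs with ha <;> simp [ha]
      have hsing : (Finset.univ.filter fun a => 0 < M.policyOf η sel x a) = {sel x} := by
        ext a
        simp [hiff]
      rw [hsing]
      simp [h, hη.eq_zero_of_marginal h]
  have hsum : ∑ x, (Finset.univ.filter fun a : M.Adm x => 0 < η ⟨x, a⟩).card =
      (Finset.univ.filter fun k : M.K => 0 < η k).card := by
    simp only [Finset.card_filter]
    rw [Fintype.sum_sigma]
  rw [← hsum, ← Finset.sum_congr rfl fun x _ => hx x, Finset.sum_add_distrib,
    Finset.card_filter] at hcard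
  unfold Model.randomizations
  convert (Nat.add_le_add_iff_right).1 hcard

end LinearProgramming

/-! ### Jump times, jump counts and predictability of the left limit. -/

section Paths

variable {S : Type*}

theorem jumpTime_zero (e : Path S) : jumpTime e 0 = 0 := by
  simp [jumpTime, e.2.1]

theorem jumpTime_succ (e : Path S) (k : ℕ) :
    jumpTime e (k + 1) = jumpTime e k + (e.1 (k + 1)).1 := by
  simp [jumpTime, Finset.sum_range_succ _ (k + 1)]

theorem jumpTime_mono (e : Path S) : Monotone (jumpTime e) :=
  monotone_nat_of_le_succ fun k => by rw [jumpTime_succ]; exact le_self_add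

theorem jumpTime_lt_succ (e : Path S) {k : ℕ} (h : jumpTime e k ≠ ∞) :
    jumpTime e k < jumpTime e (k + 1) := by
  rw [jumpTime_succ]
  exact ENNReal.lt_add_right h (e.2.2.2 k).1.ne'

theorem jumpState_eq_none_iff (e : Path S) (k : ℕ) : jumpState e k = none ↔ jumpTime e k = ∞ := by
  induction k with
  | zero => simp [jumpTime_zero, jumpState, e.2.2.1]
  | succ k ih =>
    rw [jumpTime_succ, ENNReal.add_eq_top, ← ih]
    refine ⟨fun h => Or.inr ((e.2.2.2 k).2.1.2 h), ?_⟩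
    rintro (h | h)
    · exact (e.2.2.2 k).2.2 h
    · exact (e.2.2.2 k).2.1.1 h

theorem jumpTime_ne_top {e : Path S} {k : ℕ} {x : S} (h : jumpState e k = some x) :
    jumpTime e k ≠ ∞ := by
  rw [Ne, ← jumpState_eq_none_iff, h]
  simp

theorem sojourn_unique {e : Path S} {t : ℝ≥0∞} {j k : ℕ} (hj : jumpTime e j < t)
    (hj' : t ≤ jumpTime e (j + 1)) (hk : jumpTime e k < t) (hk' : t ≤ jumpTime e (k + 1)) :
    j = k := by
  by_contra h
  rcases lt_or_gt_of_ne h with h | h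
  · exact (hj'.trans (jumpTime_mono e h)).not_gt hk
  · exact (hk'.trans (jumpTime_mono e h)).not_gt hj

theorem stateLeft_zero (e : Path S) : stateLeft e 0 = jumpState e 0 := by
  simp [stateLeft]

theorem stateLeft_of_mem {e : Path S} {t : ℝ≥0} {k : ℕ} (hk : jumpTime e k < t)
    (hk' : t ≤ jumpTime e (k + 1)) : stateLeft e t = jumpState e k := by
  classical
  have ht : t ≠ 0 := by
    rintro rfl
    simp at hk
  have h : ∃ k, jumpTime e k < t ∧ t ≤ jumpTime e (k + 1) := ⟨k, hk, hk'⟩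
  rw [stateLeft, if_neg ht, dif_pos h]
  have := Nat.find_spec h
  congr 1
  convert sojourn_unique this.1 this.2 hk hk'

theorem stateLeft_eq_some_iff {e : Path S} {t : ℝ≥0} (ht : t ≠ 0) {x : S} :
    stateLeft e t = some x ↔
      ∃ k, jumpTime e k < t ∧ t ≤ jumpTime e (k + 1) ∧ jumpState e k = some x := by
  constructor
  · intro h
    by_cases hk : ∃ k, jumpTime e k < t ∧ t ≤ jumpTime e (k + 1)
    · obtain ⟨k, h1, h2⟩ := hk
      exact ⟨k, h1, h2, (stateLeft_of_mem h1 h2).symm.trans h⟩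
    · rw [stateLeft, if_neg ht, dif_neg hk] at h
      simp at h
  · rintro ⟨k, h1, h2, h3⟩
    rw [stateLeft_of_mem h1 h2, h3]

open Classical in
theorem jumpCount_le {e : Path S} {s : ℝ≥0} {k : ℕ} (hs : s < jumpTime e k) (D : Set S) :
    jumpCount s D e ≤ ∑ i ∈ Finset.range k, if jumpState e i ∈ some '' D then 1 else 0 := by
  unfold jumpCount
  rw [tsum_eq_sum (s := Finset.range k)]
  · refine Finset.sum_le_sum fun i _ => ?_
    by_cases h : jumpState e i ∈ some '' D
    · simp only [h, and_true, if_true]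
      split_ifs <;> simp
    · simp [h]
  · intro i hi
    rw [if_neg]
    rintro ⟨h, -⟩
    exact (h.trans_lt (hs.trans_le (jumpTime_mono e (by simpa using hi)))).false

open Classical in
theorem le_jumpCount {e : Path S} {s : ℝ≥0} {k : ℕ} (hs : jumpTime e k ≤ s) (D : Set S) :
    ∑ i ∈ Finset.range (k + 1), (if jumpState e i ∈ some '' D then 1 else 0) ≤
      jumpCount s D e := by
  unfold jumpCount
  refine le_trans (Finset.sum_le_sum fun i hi => ?_) (ENNReal.sum_le_tsum (Finset.range (k + 1)))
  have : jumpTime e i ≤ s := (jumpTime_mono e (by simpa [Nat.lt_succ_iff] using hi)).trans hs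
  simp [this]

open Classical in
theorem jumpCount_eq {e : Path S} {s : ℝ≥0} {k : ℕ} (hs : jumpTime e k ≤ s)
    (hs' : s < jumpTime e (k + 1)) (D : Set S) :
    jumpCount s D e =
      ∑ i ∈ Finset.range (k + 1), if jumpState e i ∈ some '' D then 1 else 0 :=
  le_antisymm (jumpCount_le hs' D) (le_jumpCount hs D)

theorem le_jumpCount_univ {e : Path S} {s : ℝ≥0} {k : ℕ} (hs : jumpTime e k ≤ s) :
    (k + 1 : ℝ≥0∞) ≤ jumpCount s univ e := by
  classical
  refine le_trans (le_of_eq ?_) (le_jumpCount hs univ)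
  rw [Finset.sum_congr rfl fun i hi => if_pos ?_]
  · simp
  · rw [image_univ]
    have hi' : i ≤ k := by simpa [Nat.lt_succ_iff] using hi
    have : jumpState e i ≠ none := by
      rw [Ne, jumpState_eq_none_iff]
      exact ne_top_of_le_ne_top ENNReal.coe_ne_top ((jumpTime_mono e hi').trans hs)
    obtain ⟨x, hx⟩ := Option.ne_none_iff_exists.1 this
    exact ⟨x, hx⟩

theorem jumpCount_univ_le {e : Path S} {s : ℝ≥0} {k : ℕ} (hs : s < jumpTime e k) :
    jumpCount s univ e ≤ k := by
  classical
  refine (jumpCount_le hs univ).trans ((Finset.sum_le_sum (g := fun _ => 1) fun i _ => ?_).trans ?_)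
  · split_ifs <;> simp
  · simp

theorem jumpCount_univ_eq {e : Path S} {s : ℝ≥0} {k : ℕ} (hs : jumpTime e k ≤ s)
    (hs' : s < jumpTime e (k + 1)) : jumpCount s univ e = k + 1 :=
  le_antisymm (by exact_mod_cast jumpCount_univ_le hs') (le_jumpCount_univ hs)

/-- If no sojourn contained `s`, every jump time would be at most `s` and the count would exceed
every integer. -/
theorem exists_sojourn_of_jumpCount_lt_top {e : Path S} {s : ℝ≥0}
    (h : jumpCount s univ e < ∞) : ∃ k, jumpTime e k ≤ s ∧ s < jumpTime e (k + 1) := by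
  by_contra! hc
  have hall : ∀ k, jumpTime e k ≤ s := by
    intro k
    induction k with
    | zero => simp [jumpTime_zero]
    | succ k ih => exact hc k ih
  obtain ⟨n, hn⟩ := ENNReal.exists_nat_gt h.ne
  exact (hn.trans_le (le_self_add.trans (le_jumpCount_univ (hall n)))).false

open TopologicalSpace in
theorem exists_denseSeq_between {a : ℝ≥0∞} {b : ℝ≥0} (h : a < b) :
    ∃ n, a < denseSeq ℝ≥0 n ∧ denseSeq ℝ≥0 n < b := by
  lift a to ℝ≥0 using h.ne_top
  obtain ⟨_, ⟨n, rfl⟩, h1, h2⟩ := (denseRange_denseSeq ℝ≥0).exists_between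
    (ENNReal.coe_lt_coe.1 h)
  exact ⟨n, ENNReal.coe_lt_coe.2 h1, h2⟩

open TopologicalSpace in
/-- A description of the event `ξ_{t-} = x` by the jump counts at countably many times before
`t`. -/
theorem stateLeft_eq_some_iff_jumpCount {e : Path S} {t : ℝ≥0} (ht : t ≠ 0) {x : S} :
    stateLeft e t = some x ↔ ∃ n, denseSeq ℝ≥0 n < t ∧
      (jumpCount (denseSeq ℝ≥0 n) univ e < ∞ ∧ 1 ≤ jumpCount (denseSeq ℝ≥0 n) {x} e ∧
        ∀ m, denseSeq ℝ≥0 m < denseSeq ℝ≥0 n →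
          jumpCount (denseSeq ℝ≥0 m) univ e = jumpCount (denseSeq ℝ≥0 n) univ e ∨
          jumpCount (denseSeq ℝ≥0 m) {x} e < jumpCount (denseSeq ℝ≥0 n) {x} e) ∧
      ∀ m, denseSeq ℝ≥0 n ≤ denseSeq ℝ≥0 m → denseSeq ℝ≥0 m < t →
        jumpCount (denseSeq ℝ≥0 m) univ e = jumpCount (denseSeq ℝ≥0 n) univ e := by
  classical
  -- The dense time indexed by `n` is a witness inside the sojourn that contains `t`. The last
  -- clause says that no jump occurs between it and `t`. The middle clauses say that the latest jump
  -- was into `x`: at any earlier dense time either no jump is missing yet or the count of visits to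
  -- `x` is strictly smaller. The clause `1 ≤ jumpCount` settles the initial sojourn, where there
  -- may be no earlier time to compare with.
  rw [stateLeft_eq_some_iff ht]
  constructor
  · rintro ⟨k, hk, hk', hx⟩
    obtain ⟨n, hn, hn'⟩ := exists_denseSeq_between hk
    have hnk : (denseSeq ℝ≥0 n : ℝ≥0∞) < jumpTime e (k + 1) :=
      (ENNReal.coe_lt_coe.2 hn').trans_le hk'
    have hcx : jumpCount (denseSeq ℝ≥0 n) {x} e =
        (∑ i ∈ Finset.range k, if jumpState e i ∈ some '' {x} then 1 else 0) + 1 := by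
      rw [jumpCount_eq hn.le hnk, Finset.sum_range_succ]
      simp [hx]
    refine ⟨n, hn', ⟨?_, ?_, fun m hm => ?_⟩, fun m hm hm' => ?_⟩
    · rw [jumpCount_univ_eq hn.le hnk]
      exact_mod_cast ENNReal.natCast_lt_top (k + 1)
    · rw [hcx]; exact le_add_self
    · rcases le_or_gt (jumpTime e k) (denseSeq ℝ≥0 m) with h | h
      · left
        rw [jumpCount_univ_eq hn.le hnk,
          jumpCount_univ_eq h ((ENNReal.coe_lt_coe.2 hm).trans hnk)]
      · right
        rw [hcx]
        refine (jumpCount_le h {x}).trans_lt (ENNReal.lt_add_right ?_ one_ne_zero)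
        refine ENNReal.sum_ne_top.2 fun i _ => ?_
        split_ifs <;> simp
    · rw [jumpCount_univ_eq hn.le hnk, jumpCount_univ_eq (hn.le.trans (ENNReal.coe_le_coe.2 hm))
        ((ENNReal.coe_lt_coe.2 hm').trans_le hk')]
  · rintro ⟨n, hn, ⟨hfin, hone, hbef⟩, haft⟩
    obtain ⟨k, hk, hk'⟩ := exists_sojourn_of_jumpCount_lt_top hfin
    refine ⟨k, hk.trans_lt (ENNReal.coe_lt_coe.2 hn), ?_, ?_⟩
    -- If `t` lay beyond the next jump, a dense time between that jump and `t` would have a larger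
    -- total count.
    · by_contra! h
      obtain ⟨m, hm, hm'⟩ := exists_denseSeq_between h
      have h1 := haft m (ENNReal.coe_le_coe.1 (hk'.le.trans hm.le)) hm'
      have h2 := le_jumpCount_univ hm.le
      rw [h1, jumpCount_univ_eq hk hk'] at h2
      have h3 : k + 1 + 1 ≤ k + 1 := by exact_mod_cast h2
      omega
    · have hcx := jumpCount_eq hk hk' {x}
      rw [Finset.sum_range_succ] at hcx
      by_contra hx
      rw [if_neg (by simpa using hx), add_zero] at hcx
      cases k with
      | zero => simp [hcx] at hone
      | succ j =>
        -- If the latest jump was not into `x`, a dense time in the preceding sojourn has the same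
        -- count of visits to `x` but a smaller total count, which violates both alternatives in
        -- `hbef`.
        have hj : jumpTime e j ≠ ∞ := ne_top_of_le_ne_top ENNReal.coe_ne_top
          ((jumpTime_mono e j.le_succ).trans hk)
        have hj' := jumpTime_lt_succ e hj
        have hT : jumpTime e (j + 1) ≠ ∞ := ne_top_of_le_ne_top ENNReal.coe_ne_top hk
        obtain ⟨m, hm, hm'⟩ := exists_denseSeq_between (b := (jumpTime e (j + 1)).toNNReal)
          (by rwa [ENNReal.coe_toNNReal hT])
        have hm'' : (denseSeq ℝ≥0 m : ℝ≥0∞) < jumpTime e (j + 1) := by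
          rw [← ENNReal.coe_toNNReal hT]; exact ENNReal.coe_lt_coe.2 hm'
        rcases hbef m (ENNReal.coe_lt_coe.1 (hm''.trans_le hk)) with h | h
        · rw [jumpCount_univ_eq hk hk', jumpCount_univ_eq hm.le hm''] at h
          have h3 : j + 1 = j + 1 + 1 := by exact_mod_cast h
          omega
        · rw [hcx, jumpCount_eq hm.le hm''] at h
          exact h.false

section

variable [MeasurableSpace S]

theorem measurable_jumpCount_history {r s : ℝ≥0} (h : r ≤ s) {D : Set S} (hD : MeasurableSet D) :
    Measurable[history s] (jumpCount r D) := by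
  rw [measurable_iff_comap_le]
  exact le_iSup₂_of_le r h (le_iSup₂_of_le D hD le_rfl)

-- The generators of the predictable `σ`-algebra require `C` in the strict past. An event of `𝓕_s`
-- lies in the strict past of every later time, and `(s, ∞)` is the union of the `(s', ∞)` over
-- countably many `s' > s`.
open TopologicalSpace in
theorem measurableSet_predictable_prod_Ioi {s : ℝ≥0} {C : Set (Path S)}
    (hC : MeasurableSet[history s] C) : MeasurableSet[predictable S] (C ×ˢ Ioi s) := by
  have h : C ×ˢ Ioi s = ⋃ n : {n // s < denseSeq ℝ≥0 n}, C ×ˢ Ioi (denseSeq ℝ≥0 n) := by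
    ext ⟨e, t⟩
    simp only [mem_prod, mem_Ioi, mem_iUnion, Subtype.exists, exists_prop]
    constructor
    · rintro ⟨he, ht⟩
      obtain ⟨n, h1, h2⟩ := exists_denseSeq_between (ENNReal.coe_lt_coe.2 ht)
      exact ⟨n, ENNReal.coe_lt_coe.1 h1, he, h2⟩
    · rintro ⟨n, h1, he, h2⟩
      exact ⟨he, h1.trans h2⟩
  rw [h]
  refine MeasurableSet.iUnion fun n => MeasurableSpace.measurableSet_generateFrom (Or.inr
    ⟨_, C, (zero_le (a := s)).trans_lt n.2, ?_, rfl⟩)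
  exact (le_iSup₂_of_le (f := fun (t : ℝ≥0) (_ : t < denseSeq ℝ≥0 n) => history t) s n.2 le_rfl) _ hC

open TopologicalSpace in
/-- The left limit of the state is a predictable process. -/
theorem measurableSet_stateLeft [MeasurableSingletonClass S] (x : S) :
    MeasurableSet[predictable S] {p : Path S × ℝ≥0 | stateLeft p.1 p.2 = some x} := by
  -- Time zero is separate, being reached only by the generators `B × {0}`. In the second part the
  -- complement of `univ ×ˢ Ioi` makes the condition at the dense time indexed by `m` void once that
  -- time is not before `t`.
  have h : {p : Path S × ℝ≥0 | stateLeft p.1 p.2 = some x} =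
      {e | jumpCount 0 {x} e = 1} ×ˢ {0} ∪
      ⋃ n, ({e | jumpCount (denseSeq ℝ≥0 n) univ e < ∞} ∩
        {e | 1 ≤ jumpCount (denseSeq ℝ≥0 n) {x} e} ∩
        ⋂ m : {m // denseSeq ℝ≥0 m < denseSeq ℝ≥0 n},
          ({e | jumpCount (denseSeq ℝ≥0 m) univ e = jumpCount (denseSeq ℝ≥0 n) univ e} ∪
          {e | jumpCount (denseSeq ℝ≥0 m) {x} e < jumpCount (denseSeq ℝ≥0 n) {x} e})) ×ˢ
          Ioi (denseSeq ℝ≥0 n) ∩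
        ⋂ m : {m // denseSeq ℝ≥0 n ≤ denseSeq ℝ≥0 m},
          ({e | jumpCount (denseSeq ℝ≥0 m) univ e = jumpCount (denseSeq ℝ≥0 n) univ e} ×ˢ
            Ioi (denseSeq ℝ≥0 m) ∪ (univ ×ˢ Ioi (denseSeq ℝ≥0 m))ᶜ) := by
    ext ⟨e, t⟩
    by_cases ht : t = 0
    · subst ht
      have h0 : ((0 : ℝ≥0) : ℝ≥0∞) < jumpTime e (0 + 1) := by
        have := jumpTime_lt_succ e (k := 0) (by simp [jumpTime_zero])
        simpa [jumpTime_zero] using this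
      have hc := jumpCount_eq (k := 0) (by simp [jumpTime_zero]) h0 {x}
      rw [zero_add, Finset.sum_range_one] at hc
      by_cases hx : jumpState e 0 = some x
      · simp [stateLeft_zero, hx, hc]
      · simp [stateLeft_zero, hx, hc]
    · simp only [mem_ofPred_eq, stateLeft_eq_some_iff_jumpCount ht, mem_union, mem_prod,
        mem_singleton_iff, ht, and_false, false_or, mem_iUnion, mem_inter_iff, mem_iInter,
        Subtype.forall, mem_Ioi, mem_compl_iff, mem_univ, true_and]
      refine exists_congr fun n => ?_
      constructor
      · rintro ⟨h1, ⟨h2, h3, h4⟩, h5⟩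
        refine ⟨⟨⟨⟨h2, h3⟩, h4⟩, h1⟩, fun m hm => ?_⟩
        by_cases hmt : denseSeq ℝ≥0 m < t
        · exact Or.inl ⟨h5 m hm hmt, hmt⟩
        · exact Or.inr hmt
      · rintro ⟨⟨⟨⟨h2, h3⟩, h4⟩, h1⟩, h5⟩
        exact ⟨h1, ⟨h2, h3, h4⟩, fun m hm hmt => ((h5 m hm).resolve_right (not_not.2 hmt)).1⟩
  rw [h]
  have hx := measurableSet_singleton x
  refine MeasurableSet.union (MeasurableSpace.measurableSet_generateFrom (Or.inl
    ⟨_, measurable_jumpCount_history le_rfl hx (measurableSet_singleton 1), rfl⟩))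
    (MeasurableSet.iUnion fun n => MeasurableSet.inter (measurableSet_predictable_prod_Ioi ?_)
      (MeasurableSet.iInter fun m => MeasurableSet.union (measurableSet_predictable_prod_Ioi ?_)
        (measurableSet_predictable_prod_Ioi MeasurableSet.univ).compl))
  · refine MeasurableSet.inter (MeasurableSet.inter
      (measurable_jumpCount_history le_rfl MeasurableSet.univ measurableSet_Iio)
      (measurable_jumpCount_history le_rfl hx measurableSet_Ici))
      (MeasurableSet.iInter fun m => MeasurableSet.union ?_ ?_)
    · exact measurableSet_eq_fun
        (measurable_jumpCount_history m.2.le MeasurableSet.univ)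
        (measurable_jumpCount_history le_rfl MeasurableSet.univ)
    · exact measurableSet_lt
        (measurable_jumpCount_history m.2.le hx) (measurable_jumpCount_history le_rfl hx)
  · exact measurableSet_eq_fun (measurable_jumpCount_history le_rfl MeasurableSet.univ)
      (measurable_jumpCount_history m.2 MeasurableSet.univ)

end

end Paths

/-! ### Stationary kernels define policies. -/

section Stationary

variable {S A : Type*} [Fintype S] [MeasurableSpace S] [MeasurableSingletonClass S]
  [MeasurableSpace A] {N : ℕ} {M : Model S A N}

/-- As `S` is finite, the kernel takes finitely many values along `ξ_{t-}`, so predictability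
reduces to that of the events `ξ_{t-} = x`; the event `ξ_{t-} = x_∞` is the complement of their
union. -/
theorem Model.IsStationaryKernel.exists_policy {φ : (x : S) → M.Adm x → ℝ}
    (hφ : M.IsStationaryKernel φ) : ∃ π : Policy M, π.IsStationary φ := by
  classical
  let κ : Option S → Measure (Option A) := fun o => match o with
    | none => Measure.dirac none
    | some x => ∑ a : M.Adm x, ENNReal.ofReal (φ x a) • Measure.dirac (some (a : A))
  have hsum : ∀ x, ∑ a, ENNReal.ofReal (φ x a) = 1 := fun x => by
    rw [← ENNReal.ofReal_sum_of_nonneg fun a _ => (hφ x).1 a, (hφ x).2, ENNReal.ofReal_one]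
  have hone : ∀ (o : Option S) (G : Set (Option A)), M.admSet o ⊆ G → κ o G = 1 := by
    rintro (_ | x) G hG
    · have : (none : Option A) ∈ G := hG rfl
      simp only [κ]
      rw [Measure.dirac_apply_of_mem this]
    · simp only [κ, Measure.finsetSum_apply, Measure.smul_apply, smul_eq_mul]
      rw [← hsum x]
      refine Finset.sum_congr rfl fun a _ => ?_
      rw [Measure.dirac_apply_of_mem (hG ⟨a, a.2, rfl⟩), mul_one]
  refine ⟨⟨fun e t => κ (stateLeft e t), fun e t => ⟨hone _ _ (subset_univ _)⟩, fun G hG => ?_,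
    fun e t => hone _ _ le_rfl⟩, fun e t => rfl⟩
  have h : (fun p : Path S × ℝ≥0 => κ (stateLeft p.1 p.2) G) = fun p =>
      (if p ∈ ⋂ x : S, {p : Path S × ℝ≥0 | stateLeft p.1 p.2 = some x}ᶜ then κ none G else 0) +
      ∑ x : S, if p ∈ {p : Path S × ℝ≥0 | stateLeft p.1 p.2 = some x} then κ (some x) G
        else 0 := by
    funext p
    simp only [mem_iInter, mem_compl_iff, mem_ofPred_eq]
    rcases Option.eq_none_or_eq_some (stateLeft p.1 p.2) with hs | ⟨x, hs⟩ <;> simp [hs]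
  rw [h]
  exact (Measurable.ite (MeasurableSet.iInter fun x => (measurableSet_stateLeft x).compl)
    measurable_const measurable_const).add (Finset.measurable_sum _ fun x _ =>
      Measurable.ite (measurableSet_stateLeft x) measurable_const measurable_const)

end Stationary

/-! ### Predictable sets depend only on the history before the next jump. -/

section Predictability

variable {S : Type*}

theorem jumpTime_congr {e e' : Path S} {k : ℕ} (h : ∀ i ≤ k, e.1 i = e'.1 i) :
    jumpTime e k = jumpTime e' k :=
  Finset.sum_congr rfl fun i hi => by rw [h i (by simpa [Nat.lt_succ_iff] using hi)]

theorem jumpCount_congr {e e' : Path S} {k : ℕ} (h : ∀ i ≤ k, e.1 i = e'.1 i) {s : ℝ≥0}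
    (hs : s < jumpTime e (k + 1)) (hs' : s < jumpTime e' (k + 1)) (D : Set S) :
    jumpCount s D e = jumpCount s D e' := by
  unfold jumpCount
  refine tsum_congr fun i => ?_
  rcases le_or_gt i k with hi | hi
  · rw [jumpTime_congr fun j hj => h j (hj.trans hi), jumpState, jumpState, h i hi]
  · have h1 := hs.trans_le (jumpTime_mono e hi)
    have h2 := hs'.trans_le (jumpTime_mono e' hi)
    rw [if_neg fun hc => hc.1.not_gt h1, if_neg fun hc => hc.1.not_gt h2]

/-- Predictable sets do not distinguish, until the next jump, between two paths with the same
history. -/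
theorem mem_iff_of_predictable [MeasurableSpace S] {R : Set (Path S × ℝ≥0)}
    (hR : MeasurableSet[predictable S] R) {e e' : Path S} {k : ℕ} (h : ∀ i ≤ k, e.1 i = e'.1 i)
    {t : ℝ≥0} (ht0 : 0 < t) (ht : t ≤ jumpTime e (k + 1)) (ht' : t ≤ jumpTime e' (k + 1)) :
    (e, t) ∈ R ↔ (e', t) ∈ R := by
  induction R, hR using MeasurableSpace.generateFrom_induction with
  | empty => simp
  | compl R _ ih => simpa using not_congr ih
  | iUnion f _ ih => simpa using exists_congr ih
  | hC R hR _ =>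
    rcases hR with ⟨B, -, rfl⟩ | ⟨s, C, -, hC, rfl⟩
    · simp [ht0.ne']
    · simp only [mem_prod, mem_Ioi]
      refine and_congr_left fun hst => ?_
      -- The sets that do not separate `e` from `e'` form a `σ`-algebra, so it suffices to check
      -- that the jump counts at times before `t` agree on both paths.
      let m : MeasurableSpace (Path S) :=
        { MeasurableSet' := fun C => e ∈ C ↔ e' ∈ C
          measurableSet_empty := by simp
          measurableSet_compl := fun C hC => by simpa using not_congr hC
          measurableSet_iUnion := fun f hf => by simpa using exists_congr hf }
      have hle : historyLeft s ≤ m := by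
        refine iSup₂_le fun u hu => iSup₂_le fun v hv => iSup₂_le fun D _ => ?_
        rintro _ ⟨B, -, rfl⟩
        have hvt : (v : ℝ≥0∞) < t := ENNReal.coe_lt_coe.2 (hv.trans_lt (hu.trans hst))
        change jumpCount v D e ∈ B ↔ jumpCount v D e' ∈ B
        rw [jumpCount_congr h (hvt.trans_le ht) (hvt.trans_le ht')]
      exact hle C hC

end Predictability

/-! ### Truncation of a path after its `k`-th jump. -/

section Truncation

variable {S : Type*}

theorem pad_frestrictLe (k : ℕ) (e : ℕ → ℝ≥0∞ × Option S) (i : ℕ) :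
    pad (Preorder.frestrictLe (π := fun _ => ℝ≥0∞ × Option S) k e) i =
      if i ≤ k then e i else (∞, none) := by
  by_cases h : i ≤ k <;> simp [pad, h]

/-- The padding by `(∞, x_∞)` satisfies the path conditions automatically, so only the first `k`
transitions impose anything. -/
theorem pad_frestrictLe_mem_pathSet {k : ℕ} {e : ℕ → ℝ≥0∞ × Option S} :
    pad (Preorder.frestrictLe (π := fun _ => ℝ≥0∞ × Option S) k e) ∈ pathSet S ↔
      (e 0).1 = 0 ∧ (e 0).2 ≠ none ∧ ∀ j < k, 0 < (e (j + 1)).1 ∧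
        ((e (j + 1)).1 = ∞ ↔ (e (j + 1)).2 = none) ∧
        ((e j).2 = none → (e (j + 1)).2 = none) := by
  simp only [pathSet, mem_ofPred_eq, pad_frestrictLe, Nat.zero_le, if_true]
  refine and_congr_right fun _ => and_congr_right fun _ => forall_congr' fun j => ?_
  by_cases hj : j < k
  · simp [hj, hj.le]
  · simp [hj]

/-- The path which follows `e` up to its `k`-th jump and has no further jumps. -/
def trunc (k : ℕ) (e : Path S) : Path S :=
  ⟨pad (Preorder.frestrictLe (π := fun _ => ℝ≥0∞ × Option S) k e.1),
    pad_frestrictLe_mem_pathSet.2 ⟨e.2.1, e.2.2.1, fun j _ => e.2.2.2 j⟩⟩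

theorem trunc_apply_of_le {k i : ℕ} (h : i ≤ k) (e : Path S) : (trunc k e).1 i = e.1 i := by
  exact (pad_frestrictLe k e.1 i).trans (if_pos h)

theorem jumpTime_trunc (k : ℕ) (e : Path S) : jumpTime (trunc k e) k = jumpTime e k :=
  jumpTime_congr fun _ hi => trunc_apply_of_le hi e

theorem jumpTime_trunc_succ (k : ℕ) (e : Path S) : jumpTime (trunc k e) (k + 1) = ∞ := by
  have h : (trunc k e).1 (k + 1) = (∞, none) :=
    (pad_frestrictLe k e.1 (k + 1)).trans (if_neg (by simp))
  rw [jumpTime_succ, h]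
  exact add_top _

theorem jumpState_trunc (k : ℕ) (e : Path S) : jumpState (trunc k e) k = jumpState e k := by
  rw [jumpState, trunc_apply_of_le le_rfl, jumpState]

variable [MeasurableSpace S]

theorem measurable_pad (k : ℕ) : Measurable (pad : Prefix S k → ℕ → ℝ≥0∞ × Option S) := by
  refine measurable_pi_lambda _ fun i => ?_
  unfold pad
  by_cases hi : i ∈ Finset.Iic k
  · simp only [hi, dif_pos]; exact measurable_pi_apply _
  · simp only [hi]; exact measurable_const

end Truncation

/-! ### The law of the controlled process and conditioning on the history. -/

section Law

variable {S A : Type*} [Fintype S] [MeasurableSpace S] [MeasurableSingletonClass S]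
  [MeasurableSpace A] [MeasurableSingletonClass A] {N : ℕ} {M : Model S A N}

/-- The law of the sequence `(θ₀, x₀), (θ₁, x₁), …` on the product space. -/
noncomputable abbrev seqLaw (π : Policy M) (x : S) : Measure (ℕ → ℝ≥0∞ × Option S) :=
  Kernel.traj (X := fun _ => ℝ≥0∞ × Option S) (stepKernel π) 0 fun _ => (0, some x)

theorem map_seqLaw_eq_compProd (π : Policy M) (x : S) (k : ℕ) :
    (seqLaw π x).map (fun e => (Preorder.frestrictLe (π := fun _ => ℝ≥0∞ × Option S) k e,
      e (k + 1))) =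
    (seqLaw π x).map (Preorder.frestrictLe (π := fun _ => ℝ≥0∞ × Option S) k) ⊗ₘ
      stepKernel π k := by
  rw [seqLaw, Kernel.traj_map_frestrictLe_apply, Kernel.partialTraj_compProd_eq_map_traj zero_le]

theorem seqLaw_ae_zero (π : Policy M) (x : S) : ∀ᵐ e ∂(seqLaw π x), e 0 = (0, some x) := by
  have h := Kernel.traj_map_frestrictLe_apply (X := fun _ => ℝ≥0∞ × Option S)
    (κ := stepKernel π) 0 0 (fun _ => (0, some x))
  rw [Kernel.partialTraj_self, Kernel.id_apply] at h
  have hm : MeasurableSet {p : Prefix S 0 | p ⟨0, by simp⟩ = (0, some x)} :=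
    (measurable_pi_apply _) (measurableSet_singleton _)
  have h2 : ∀ᵐ p ∂((seqLaw π x).map (Preorder.frestrictLe (π := fun _ => ℝ≥0∞ × Option S) 0)),
      p ⟨0, by simp⟩ = (0, some x) := by
    rw [seqLaw, h, ae_dirac_iff hm]
  exact ae_of_ae_map (Preorder.measurable_frestrictLe 0).aemeasurable h2

theorem jumpRate_eq_zero {π : Policy M} {k : ℕ} {e : Path S} (h : jumpState e k = none) (y : S)
    (t : ℝ) : jumpRate π k e y t = 0 := by
  simp [jumpRate, h]

theorem measurable_ofReal_prodMk (y : S) : Measurable fun t : ℝ => (ENNReal.ofReal t, some y) :=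
  ENNReal.measurable_ofReal.prodMk measurable_const

theorem lintegral_sojournLaw (π : Policy M) (k : ℕ) (e : Path S)
    {f : ℝ≥0∞ × Option S → ℝ≥0∞} (hf : Measurable f) :
    ∫⁻ z, f z ∂(sojournLaw π k e) =
      (∑ y, ∫⁻ t in Ioi (0 : ℝ), jumpRate π k e y t *
        EReal.exp (-((∫⁻ v in Ioc 0 t, ∑ z, jumpRate π k e z v : ℝ≥0∞) : EReal)) *
          f (ENNReal.ofReal t, some y)) +
      EReal.exp (-((∫⁻ v in Ioi (0 : ℝ), ∑ z, jumpRate π k e z v : ℝ≥0∞) : EReal)) *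
        f (∞, none) := by
  rw [sojournLaw, lintegral_add_measure, lintegral_finsetSum_measure, lintegral_smul_measure,
    lintegral_dirac' _ hf, smul_eq_mul]
  congr 1
  refine Finset.sum_congr rfl fun y _ => ?_
  have hm : Measurable fun t : ℝ => jumpRate π k e y t *
      EReal.exp (-((∫⁻ v in Ioc 0 t, ∑ z, jumpRate π k e z v : ℝ≥0∞) : EReal)) :=
    ((measurable_jumpRate π k y).comp measurable_prodMk_left).mul
      ((measurable_survival π k).comp (measurable_prodMk_left (x := e)))
  rw [lintegral_map hf (measurable_ofReal_prodMk y)]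
  exact lintegral_withDensity_eq_lintegral_mul _ hm (hf.comp (measurable_ofReal_prodMk y))

/-- These are the conditions on one transition in `pathSet`. The absolutely continuous part lives on
finite positive times and vanishes if `x_k = x_∞`; the atom is at `(∞, x_∞)`. -/
theorem sojournLaw_ae (π : Policy M) (k : ℕ) (e : Path S) :
    ∀ᵐ z ∂(sojournLaw π k e), 0 < z.1 ∧ (z.1 = ∞ ↔ z.2 = none) ∧
      (jumpState e k = none → z.2 = none) := by
  classical
  have h1 : MeasurableSet {z : ℝ≥0∞ × Option S | z.2 = none} :=
    measurable_snd (measurableSet_singleton none)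
  have hm : MeasurableSet {z : ℝ≥0∞ × Option S | 0 < z.1 ∧ (z.1 = ∞ ↔ z.2 = none) ∧
      (jumpState e k = none → z.2 = none)} := by
    refine (measurableSet_lt measurable_const measurable_fst).inter
      (((measurable_fst (measurableSet_singleton ∞)).iff h1).inter ?_)
    exact (MeasurableSet.const _).imp h1
  rw [ae_iff, ← compl_ofPred, ← lintegral_indicator_one hm.compl,
    lintegral_sojournLaw _ _ _ (measurable_one.indicator hm.compl)]
  rw [add_eq_zero]
  constructor
  · refine Finset.sum_eq_zero fun y _ => ?_
    refine (setLIntegral_congr_fun measurableSet_Ioi fun t ht => ?_).trans lintegral_zero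
    have ht' : (0 : ℝ) < t := ht
    by_cases hs : jumpState e k = none
    · simp [jumpRate_eq_zero hs]
    · rw [indicator_of_notMem, mul_zero]
      simp [ht', hs]
  · rw [indicator_of_notMem, mul_zero]
    simp

open Classical in
theorem stepKernel_apply_of_mem (π : Policy M) (k : ℕ) {h : Prefix S k} (hh : pad h ∈ pathSet S) :
    stepKernel π k h = sojournLaw π k ⟨pad h, hh⟩ := by
  change (if hh : pad h ∈ pathSet S then sojournLaw π k ⟨pad h, hh⟩
    else Measure.dirac (∞, none)) = _
  rw [dif_pos hh]

theorem seqLaw_ae_pad_mem (π : Policy M) (x : S) (k : ℕ) : ∀ᵐ e ∂(seqLaw π x),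
    pad (Preorder.frestrictLe (π := fun _ => ℝ≥0∞ × Option S) k e) ∈ pathSet S := by
  induction k with
  | zero =>
    filter_upwards [seqLaw_ae_zero π x] with e he
    rw [pad_frestrictLe_mem_pathSet]
    simp [he]
  | succ k ih =>
    -- `G` is the legality of transition `k + 1`. It holds almost surely under the one-step kernel
    -- from legal prefixes, and the induction hypothesis provides these.
    let G : Set (Prefix S k × (ℝ≥0∞ × Option S)) := {p | 0 < p.2.1 ∧ (p.2.1 = ∞ ↔ p.2.2 = none) ∧
      ((p.1 ⟨k, by simp⟩).2 = none → p.2.2 = none)}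
    have h1 : MeasurableSet {p : Prefix S k × (ℝ≥0∞ × Option S) | p.2.2 = none} :=
      (measurable_snd.comp measurable_snd) (measurableSet_singleton none)
    have hG : MeasurableSet G := by
      refine (measurableSet_lt measurable_const (measurable_fst.comp measurable_snd)).inter
        ((((measurable_fst.comp measurable_snd) (measurableSet_singleton ∞)).iff h1).inter ?_)
      exact ((measurable_snd.comp ((measurable_pi_apply _).comp measurable_fst))
        (measurableSet_singleton none)).imp h1
    have hmap : ∀ᵐ p ∂((seqLaw π x).map (fun e => (Preorder.frestrictLe
        (π := fun _ => ℝ≥0∞ × Option S) k e, e (k + 1)))), p ∈ G := by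
      rw [map_seqLaw_eq_compProd]
      refine Measure.ae_compProd_of_ae_ae hG ?_
      have hP : MeasurableSet {h : Prefix S k | pad h ∈ pathSet S} :=
        measurable_pad k measurableSet_pathSet
      have ih' : ∀ᵐ h ∂((seqLaw π x).map (Preorder.frestrictLe
          (π := fun _ => ℝ≥0∞ × Option S) k)), pad h ∈ pathSet S :=
        (ae_map_iff (Preorder.measurable_frestrictLe k).aemeasurable hP).2 ih
      filter_upwards [ih'] with h hh
      rw [stepKernel_apply_of_mem π k hh]
      filter_upwards [sojournLaw_ae π k ⟨pad h, hh⟩] with z hz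
      refine ⟨hz.1, hz.2.1, fun hn => hz.2.2 ?_⟩
      simpa [jumpState, pad] using hn
    have hstep := ae_of_ae_map ((Preorder.measurable_frestrictLe k).prodMk
      (measurable_pi_apply (k + 1))).aemeasurable hmap
    filter_upwards [ih, hstep] with e h1 h2
    rw [pad_frestrictLe_mem_pathSet] at h1 ⊢
    refine ⟨h1.1, h1.2.1, fun j hj => ?_⟩
    rcases (Nat.lt_succ_iff.1 hj).lt_or_eq with h | rfl
    · exact h1.2.2 j h
    · exact h2

theorem seqLaw_ae_mem_pathSet (π : Policy M) (x : S) : ∀ᵐ e ∂(seqLaw π x), e ∈ pathSet S := by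
  filter_upwards [ae_all_iff.2 (seqLaw_ae_pad_mem π x)] with e he
  simp only [pad_frestrictLe_mem_pathSet] at he
  exact ⟨(he 0).1, (he 0).2.1, fun k => (he (k + 1)).2.2 k k.lt_succ_self⟩

/-- Restriction to paths loses no mass, because the Ionescu-Tulcea measure is concentrated on
`pathSet S`. -/
theorem lintegral_law (π : Policy M) (x : S) (f : (ℕ → ℝ≥0∞ × Option S) → ℝ≥0∞) :
    ∫⁻ e, f e.1 ∂(law π x) = ∫⁻ e, f e ∂(seqLaw π x) := by
  rw [law, lintegral_subtype_comap measurableSet_pathSet,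
    Measure.restrict_eq_self_of_ae_mem (seqLaw_ae_mem_pathSet π x)]

instance (π : Policy M) (x : S) : IsProbabilityMeasure (law π x) := by
  constructor
  have h := lintegral_law π x fun _ => 1
  simpa only [lintegral_one, measure_univ] using h

theorem law_ae_jumpState_zero (π : Policy M) (x : S) :
    ∀ᵐ e ∂(law π x), jumpState e 0 = some x := by
  have hm : MeasurableSet {e : Path S | jumpState e 0 = some x} :=
    measurable_jumpState 0 (measurableSet_singleton _)
  have hm' : MeasurableSet {e : ℕ → ℝ≥0∞ × Option S | (e 0).2 = some x} :=
    (measurable_snd.comp (measurable_pi_apply 0)) (measurableSet_singleton _)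
  have h := lintegral_law π x ({e | (e 0).2 = some x}ᶜ.indicator 1)
  rw [lintegral_indicator_one hm'.compl] at h
  have h0 : seqLaw π x {e | (e 0).2 = some x}ᶜ = 0 := by
    have := seqLaw_ae_zero π x
    exact mem_ae_iff.1 (this.mono fun e he => by simp [he])
  rw [h0] at h
  rw [ae_iff, ← compl_ofPred, ← lintegral_indicator_one hm.compl]
  exact h

/-- The conditional law of the next sojourn time and state, given the history. -/
theorem lintegral_law_step (π : Policy M) (x : S) (k : ℕ)
    {f : Path S × (ℝ≥0∞ × Option S) → ℝ≥0∞} (hf : Measurable f) :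
    ∫⁻ e, f (trunc k e, e.1 (k + 1)) ∂(law π x) =
      ∫⁻ e, ∫⁻ z, f (trunc k e, z) ∂(sojournLaw π k (trunc k e)) ∂(law π x) := by
  classical
  -- The integrand is transported to prefixes, where the one-step disintegration is available; its
  -- value at prefixes that are not legal is irrelevant.
  let F : Prefix S k × (ℝ≥0∞ × Option S) → ℝ≥0∞ := fun p =>
    if h : pad p.1 ∈ pathSet S then f (⟨pad p.1, h⟩, p.2) else 0
  have hF : Measurable F := by
    have hp : Measurable fun p : Prefix S k × (ℝ≥0∞ × Option S) => pad p.1 :=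
      (measurable_pad k).comp measurable_fst
    refine Measurable.dite (s := (fun p : Prefix S k × (ℝ≥0∞ × Option S) => pad p.1) ⁻¹' pathSet S)
      (f := fun p => f (⟨pad p.1.1, p.2⟩, p.1.2)) (g := fun _ => 0) ?_ measurable_const
      (hp measurableSet_pathSet)
    exact hf.comp ((hp.comp measurable_subtype_coe).subtype_mk.prodMk
      (measurable_snd.comp measurable_subtype_coe))
  have hFe : ∀ (e : Path S) z, F (Preorder.frestrictLe (π := fun _ => ℝ≥0∞ × Option S) k e.1, z) =
      f (trunc k e, z) := fun e z => dif_pos (trunc k e).2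
  have h1 := lintegral_law π x fun e =>
    F (Preorder.frestrictLe (π := fun _ => ℝ≥0∞ × Option S) k e, e (k + 1))
  have h2 := lintegral_law π x fun e =>
    ∫⁻ z, F (Preorder.frestrictLe (π := fun _ => ℝ≥0∞ × Option S) k e, z)
      ∂(stepKernel π k (Preorder.frestrictLe (π := fun _ => ℝ≥0∞ × Option S) k e))
  simp only [hFe] at h1 h2
  have h3 : ∀ e : Path S, stepKernel π k
      (Preorder.frestrictLe (π := fun _ => ℝ≥0∞ × Option S) k e.1) =
      sojournLaw π k (trunc k e) := fun e => stepKernel_apply_of_mem π k (trunc k e).2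
  simp only [h3] at h2
  rw [h1, h2, ← lintegral_map (f := F) (g := fun e => (Preorder.frestrictLe
    (π := fun _ => ℝ≥0∞ × Option S) k e, e (k + 1))) hF
    ((Preorder.measurable_frestrictLe k).prodMk (measurable_pi_apply (k + 1))),
    map_seqLaw_eq_compProd, Measure.lintegral_compProd hF,
    lintegral_map (hF.lintegral_kernel_prod_right') (Preorder.measurable_frestrictLe k)]

end Law

/-! ### Discounting over random intervals. -/

section Discount

/-- The discount factor `e^{-αT}`, which is zero at `T = ∞`. -/
noncomputable def disc (α : ℝ) (T : ℝ≥0∞) : ℝ≥0∞ :=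
  if T = ∞ then 0 else ENNReal.ofReal (Real.exp (-α * T.toReal))

theorem disc_top (α : ℝ) : disc α ∞ = 0 := if_pos rfl

theorem disc_zero (α : ℝ) : disc α 0 = 1 := by simp [disc]

theorem disc_ofReal (α : ℝ) {t : ℝ} (ht : 0 ≤ t) :
    disc α (ENNReal.ofReal t) = ENNReal.ofReal (Real.exp (-α * t)) := by
  rw [disc, if_neg ENNReal.ofReal_ne_top, ENNReal.toReal_ofReal ht]

theorem measurable_disc (α : ℝ) : Measurable (disc α) :=
  Measurable.ite (measurableSet_singleton ∞) measurable_const (by fun_prop)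

theorem measurable_discountFactor (α : ℝ) :
    Measurable fun t : ℝ => ENNReal.ofReal (Real.exp (-α * t)) := by fun_prop

theorem measurableSet_lt_ofReal (T : ℝ≥0∞) : MeasurableSet {t : ℝ | T < ENNReal.ofReal t} :=
  measurableSet_lt measurable_const ENNReal.measurable_ofReal

theorem lintegral_discount_after {α : ℝ} (hα : 0 < α) (T : ℝ≥0∞) :
    ENNReal.ofReal α * ∫⁻ t in {t : ℝ | T < ENNReal.ofReal t},
      ENNReal.ofReal (Real.exp (-α * t)) = disc α T := by
  by_cases hT : T = ∞
  · subst hT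
    simp [disc_top]
  · have hset : {t : ℝ | T < ENNReal.ofReal t} = Ioi T.toReal := by
      ext t
      exact ENNReal.lt_ofReal_iff_toReal_lt hT
    rw [hset, disc, if_neg hT, ← ofReal_integral_eq_lintegral_ofReal
      (integrableOn_exp_mul_Ioi (by linarith) _) (ae_of_all _ fun t => (Real.exp_pos _).le),
      ← ENNReal.ofReal_mul hα.le, integral_exp_mul_Ioi (by linarith)]
    congr 1
    field_simp

/-- The additive form of `α ∫_T^{T'} e^{-αt} dt = e^{-αT} - e^{-αT'}`, which avoids subtraction in
`ℝ≥0∞` and includes infinite endpoints. -/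
theorem lintegral_discount_between {α : ℝ} (hα : 0 < α) {T T' : ℝ≥0∞} (h : T ≤ T') :
    ENNReal.ofReal α * (∫⁻ t in {t : ℝ | T < ENNReal.ofReal t ∧ ENNReal.ofReal t ≤ T'},
      ENNReal.ofReal (Real.exp (-α * t))) + disc α T' = disc α T := by
  rw [← lintegral_discount_after hα T, ← lintegral_discount_after hα T', ← mul_add,
    ← lintegral_union (measurableSet_lt_ofReal T')]
  · congr 3
    ext t
    simp only [mem_union, mem_ofPred_eq]
    constructor
    · rintro (h1 | h1)
      · exact h1.1
      · exact h.trans_lt h1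
    · intro h1
      rcases le_or_gt (ENNReal.ofReal t) T' with h2 | h2
      · exact Or.inl ⟨h1, h2⟩
      · exact Or.inr h2
  · rw [Set.disjoint_left]
    intro t h1 h2
    exact h1.2.not_gt h2

/-- The density of the first jump before `T` and the survival probability at `T` add up to one. -/
theorem survival_mass_until {m : ℝ → ℝ≥0∞} (hm : Measurable m) {C : ℝ≥0} (hC : ∀ t, m t ≤ C)
    (T : ℝ) :
    (∫⁻ t in Ioc (0 : ℝ) T, m t * EReal.exp (-((∫⁻ v in Ioc 0 t, m v : ℝ≥0∞) : EReal))) +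
      EReal.exp (-((∫⁻ v in Ioc (0 : ℝ) T, m v : ℝ≥0∞) : EReal)) = 1 := by
  -- Switching the rate off after `T` turns the total mass identity into the identity up to `T`.
  have h := survival_mass (hm.indicator (measurableSet_Iic (a := T))) C fun t =>
    (indicator_le_self _ _ t).trans (hC t)
  rw [setLIntegral_indicator measurableSet_Iic, Iic_inter_Ioi] at h
  rw [← h]
  congr 1
  rw [← Iic_inter_Ioi, ← setLIntegral_indicator measurableSet_Iic]
  refine lintegral_congr fun t => ?_
  by_cases ht : t ∈ Iic T
  · rw [indicator_of_mem ht, indicator_of_mem ht]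
    congr 4
    refine setLIntegral_congr_fun measurableSet_Ioc fun v hv => ?_
    exact (indicator_of_mem (show v ∈ Iic T from hv.2.trans ht) m).symm
  · rw [indicator_of_notMem ht, indicator_of_notMem ht, zero_mul]

end Discount

/-! ### Discounted occupation measures and their balance equation. -/

section Occupation

variable {S A : Type*} [Fintype S] [MeasurableSpace S] [MeasurableSingletonClass S]
  [MeasurableSpace A] [MeasurableSingletonClass A] {N : ℕ} {M : Model S A N}

/-- The probability that the sojourn lasts at least up to time `t`. -/
theorem sojournLaw_ge (π : Policy M) (k : ℕ) (e : Path S) {t : ℝ} (ht : 0 < t) :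
    sojournLaw π k e {z | ENNReal.ofReal t ≤ z.1} =
      EReal.exp (-((∫⁻ v in Ioc 0 t, ∑ z, jumpRate π k e z v : ℝ≥0∞) : EReal)) := by
  have := isProbabilityMeasure_sojournLaw π k e
  have hm : MeasurableSet {z : ℝ≥0∞ × Option S | z.1 < ENNReal.ofReal t} :=
    measurableSet_lt measurable_fst measurable_const
  have hr : ∀ z, Measurable (jumpRate π k e z) := fun z =>
    (measurable_jumpRate π k z).comp measurable_prodMk_left
  have hv : Measurable fun t : ℝ =>
      EReal.exp (-((∫⁻ v in Ioc 0 t, ∑ z, jumpRate π k e z v : ℝ≥0∞) : EReal)) :=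
    (measurable_survival π k).comp (measurable_prodMk_left (x := e))
  obtain ⟨C, hC⟩ := exists_jumpRate_le π k e
  have h1 := survival_mass_until (Finset.measurable_sum Finset.univ fun z _ => hr z) hC t
  have h2 : sojournLaw π k e {z | z.1 < ENNReal.ofReal t} =
      ∫⁻ s in Ioc (0 : ℝ) t, (∑ z, jumpRate π k e z s) *
        EReal.exp (-((∫⁻ v in Ioc 0 s, ∑ z, jumpRate π k e z v : ℝ≥0∞) : EReal)) := by
    rw [← lintegral_indicator_one hm, lintegral_sojournLaw _ _ _ (measurable_one.indicator hm)]
    rw [indicator_of_notMem (by simp), mul_zero, add_zero]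
    simp_rw [Finset.sum_mul]
    refine Eq.trans ?_ (lintegral_finsetSum _ fun y _ => (hr y).mul hv).symm
    refine Finset.sum_congr rfl fun y _ => ?_
    -- The event is `θ < t` with strict inequality, so the endpoint is dropped as a null set.
    rw [← setLIntegral_congr Ioo_ae_eq_Ioc]
    rw [← Iio_inter_Ioi, ← setLIntegral_indicator measurableSet_Iio]
    refine setLIntegral_congr_fun measurableSet_Ioi fun s hs => ?_
    by_cases hst : s < t
    · simp [hst, ht]
    · simp [hst, ht]
  have h3 : {z : ℝ≥0∞ × Option S | ENNReal.ofReal t ≤ z.1} =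
      {z | z.1 < ENNReal.ofReal t}ᶜ := by
    ext z
    simp
  have h4 := measure_add_measure_compl (μ := sojournLaw π k e) hm
  rw [measure_univ, ← h1, ← h2, ← h3] at h4
  exact (ENNReal.add_right_inj (measure_ne_top _ _)).1 h4

theorem Policy.measurable_apply (π : Policy M) (a : A) :
    Measurable fun p : Path S × ℝ≥0 => π.toFun p.1 p.2 {some a} :=
  (π.meas {some a} (measurableSet_singleton _)).mono predictable_le le_rfl

/-- Until its next jump, a policy does not distinguish a path from its truncation. -/
theorem Policy.toFun_trunc (π : Policy M) (a : A) (e : Path S) (k : ℕ) {t : ℝ≥0} (ht0 : 0 < t)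
    (ht : t ≤ jumpTime e (k + 1)) :
    π.toFun (trunc k e) t {some a} = π.toFun e t {some a} := by
  -- The level set of the policy at its value on `e` is predictable, hence it also contains the
  -- truncated path, whose next jump is at `∞`.
  have hR : MeasurableSet[predictable S] ((fun p : Path S × ℝ≥0 => π.toFun p.1 p.2 {some a}) ⁻¹'
      {π.toFun e t {some a}}) :=
    π.meas {some a} (measurableSet_singleton _) (measurableSet_singleton _)
  exact (mem_iff_of_predictable hR (e := e) (e' := trunc k e)
    (fun i hi => (trunc_apply_of_le hi e).symm) ht0 ht (by simp [jumpTime_trunc_succ])).1 rfl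

theorem Policy.sum_apply (π : Policy M) {e : Path S} {t : ℝ≥0} {x : S}
    (h : stateLeft e t = some x) : ∑ a : M.Adm x, π.toFun e t {some (a : A)} = 1 := by
  classical
  rw [← π.adm e t, h, Model.admSet]
  have himg : (some '' (M.Adm x : Set A) : Set (Option A)) =
      ((M.Adm x).image some : Finset (Option A)) := by simp
  rw [himg, ← sum_measure_singleton, Finset.sum_image fun a _ b _ => Option.some_inj.1,
    Finset.sum_coe_sort (M.Adm x) fun a => π.toFun e t {some a}]

open Classical in
/-- The discounted time during which the action `a` is used at the state `x` between the `k`-th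
and the next jump. -/
noncomputable def sojournOcc (π : Policy M) (k : ℕ) (x : S) (a : A) (e : Path S) : ℝ≥0∞ :=
  ∫⁻ t in Ioi (0 : ℝ), ENNReal.ofReal (Real.exp (-M.α * t)) *
    if jumpTime e k < ENNReal.ofReal t ∧ ENNReal.ofReal t ≤ jumpTime e (k + 1) ∧
      jumpState e k = some x then π.toFun e t.toNNReal {some a} else 0

open Classical in
/-- The expected discounted time during which the action `a` is used at the state `x`. -/
noncomputable def occ (π : Policy M) (x₀ x : S) (a : A) : ℝ≥0∞ :=
  ∫⁻ t in Ioi (0 : ℝ), ENNReal.ofReal (Real.exp (-M.α * t)) *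
    ∫⁻ e, (if stateLeft e t.toNNReal = some x then π.toFun e t.toNNReal {some a} else 0)
      ∂(law π x₀)

theorem measurable_toFun_real (π : Policy M) (a : A) :
    Measurable fun p : Path S × ℝ => π.toFun p.1 p.2.toNNReal {some a} :=
  (π.measurable_apply a).comp (measurable_fst.prodMk measurable_snd.real_toNNReal)

theorem measurableSet_sojourn (k : ℕ) (x : S) : MeasurableSet {p : Path S × ℝ |
    jumpTime p.1 k < ENNReal.ofReal p.2 ∧ ENNReal.ofReal p.2 ≤ jumpTime p.1 (k + 1) ∧
      jumpState p.1 k = some x} := by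
  have h1 : ∀ k, Measurable fun p : Path S × ℝ => jumpTime p.1 k :=
    fun k => (measurable_jumpTime k).comp measurable_fst
  have h2 : Measurable fun p : Path S × ℝ => ENNReal.ofReal p.2 :=
    ENNReal.measurable_ofReal.comp measurable_snd
  exact (measurableSet_lt (h1 k) h2).inter ((measurableSet_le h2 (h1 (k + 1))).inter
    (((measurable_jumpState k).comp measurable_fst) (measurableSet_singleton (some x))))

open Classical in
theorem measurable_sojournOcc_integrand (π : Policy M) (k : ℕ) (x : S) (a : A) :
    Measurable fun p : Path S × ℝ => ENNReal.ofReal (Real.exp (-M.α * p.2)) *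
      if jumpTime p.1 k < ENNReal.ofReal p.2 ∧ ENNReal.ofReal p.2 ≤ jumpTime p.1 (k + 1) ∧
        jumpState p.1 k = some x then π.toFun p.1 p.2.toNNReal {some a} else 0 :=
  ((measurable_discountFactor M.α).comp measurable_snd).mul
    (Measurable.ite (measurableSet_sojourn k x) (measurable_toFun_real π a) measurable_const)

theorem measurable_sojournOcc (π : Policy M) (k : ℕ) (x : S) (a : A) :
    Measurable (sojournOcc π k x a) :=
  (measurable_sojournOcc_integrand π k x a).lintegral_prod_right'

theorem ofReal_exp_ne_top (α t : ℝ) : ENNReal.ofReal (Real.exp (-α * t)) ≠ ∞ :=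
  ENNReal.ofReal_ne_top

/-- The sojourn intervals `(T_k, T_{k+1}]` are disjoint and cover all positive times with `ξ_{t-} ∈
S`. Times after `T_∞` contribute nothing to either side. -/
theorem occ_eq_tsum (π : Policy M) (x₀ x : S) (a : A) :
    occ π x₀ x a = ∑' k, ∫⁻ e, sojournOcc π k x a e ∂(law π x₀) := by
  classical
  rw [occ, ← lintegral_tsum fun k => (measurable_sojournOcc π k x a).aemeasurable]
  simp only [sojournOcc]
  have h1 : ∀ e : Path S, ∑' k, ∫⁻ t in Ioi (0 : ℝ), (ENNReal.ofReal (Real.exp (-M.α * t)) *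
      if jumpTime e k < ENNReal.ofReal t ∧ ENNReal.ofReal t ≤ jumpTime e (k + 1) ∧
        jumpState e k = some x then π.toFun e t.toNNReal {some a} else 0) =
      ∫⁻ t in Ioi (0 : ℝ), ∑' k, (ENNReal.ofReal (Real.exp (-M.α * t)) *
      if jumpTime e k < ENNReal.ofReal t ∧ ENNReal.ofReal t ≤ jumpTime e (k + 1) ∧
        jumpState e k = some x then π.toFun e t.toNNReal {some a} else 0) := fun e =>
    (lintegral_tsum fun k => ((measurable_sojournOcc_integrand π k x a).comp
      (measurable_prodMk_left (x := e))).aemeasurable).symm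
  simp_rw [h1]
  rw [lintegral_lintegral_swap (Measurable.tsum fun k =>
    measurable_sojournOcc_integrand π k x a).aemeasurable]
  refine setLIntegral_congr_fun measurableSet_Ioi fun t ht => ?_
  have ht0 : t.toNNReal ≠ 0 := (Real.toNNReal_pos.2 ht).ne'
  rw [← lintegral_const_mul' _ _ (ofReal_exp_ne_top _ _)]
  refine lintegral_congr fun e => ?_
  rw [ENNReal.tsum_mul_left]
  congr 1
  by_cases hs : stateLeft e t.toNNReal = some x
  · rw [if_pos hs]
    obtain ⟨k, h1, h2, h3⟩ := (stateLeft_eq_some_iff ht0).1 hs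
    rw [tsum_eq_single k, if_pos ⟨h1, h2, h3⟩]
    intro j hj
    exact if_neg fun h => hj (sojourn_unique h.1 h.2.1 h1 h2)
  · rw [if_neg hs]
    exact (ENNReal.tsum_eq_zero.2 fun k => if_neg fun h =>
      hs ((stateLeft_eq_some_iff ht0).2 ⟨k, h⟩)).symm

theorem occ_ne_top (π : Policy M) (x₀ x : S) (a : A) : occ π x₀ x a ≠ ∞ := by
  classical
  have h := lintegral_discount_after M.α_pos 0
  have hset : {t : ℝ | 0 < ENNReal.ofReal t} = Ioi 0 := by ext; simp
  rw [hset, disc_zero] at h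
  have hfin : ∫⁻ t in Ioi (0 : ℝ), ENNReal.ofReal (Real.exp (-M.α * t)) ≠ ∞ := by
    intro hc
    rw [hc, ENNReal.mul_top (by simpa using M.α_pos)] at h
    simp at h
  refine ne_top_of_le_ne_top hfin (lintegral_mono fun t => ?_)
  refine mul_le_of_le_one_right' ?_
  calc _ ≤ ∫⁻ e, 1 ∂(law π x₀) := lintegral_mono fun e => by
        have := π.prob e t.toNNReal
        split_ifs
        · exact prob_le_one
        · exact zero_le
    _ = 1 := by simp

-- While the state is `x`, the policy puts total mass one on `A(x)`, so the sum over actions leaves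
-- the plain discounted length of the sojourn.
open Classical in
theorem sojournOcc_balance (π : Policy M) (k : ℕ) (x : S) (e : Path S) :
    ENNReal.ofReal M.α * ∑ a : M.Adm x, sojournOcc π k x a e +
      (if jumpState e k = some x then disc M.α (jumpTime e (k + 1)) else 0) =
      if jumpState e k = some x then disc M.α (jumpTime e k) else 0 := by
  by_cases hx : jumpState e k = some x
  · rw [if_pos hx, if_pos hx, ← lintegral_discount_between M.α_pos (jumpTime_mono e k.le_succ)]
    congr 2
    simp only [sojournOcc]
    refine (lintegral_finsetSum Finset.univ fun (a : M.Adm x) _ =>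
      (measurable_sojournOcc_integrand π k x (a : A)).comp (measurable_prodMk_left (x := e))).symm.trans ?_
    have hm : MeasurableSet {t : ℝ | jumpTime e k < ENNReal.ofReal t ∧
        ENNReal.ofReal t ≤ jumpTime e (k + 1)} := (measurableSet_lt_ofReal _).inter
      (measurableSet_le ENNReal.measurable_ofReal measurable_const)
    rw [← lintegral_indicator hm, ← lintegral_indicator measurableSet_Ioi]
    refine lintegral_congr fun t => ?_
    by_cases ht : t ∈ {t : ℝ | jumpTime e k < ENNReal.ofReal t ∧
        ENNReal.ofReal t ≤ jumpTime e (k + 1)}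
    · have ht0 : t ∈ Ioi (0 : ℝ) := ENNReal.ofReal_pos.1 (zero_le.trans_lt ht.1)
      rw [indicator_of_mem ht, indicator_of_mem ht0]
      simp only [Function.comp_apply]
      rw [← Finset.mul_sum]
      simp only [ht.1, ht.2, hx, and_self, if_true]
      rw [π.sum_apply ((stateLeft_of_mem ht.1 ht.2).trans hx), mul_one]
    · rw [indicator_of_notMem ht]
      refine indicator_apply_eq_zero.2 fun _ => Finset.sum_eq_zero fun a _ => ?_
      simp only [Function.comp_apply]
      rw [if_neg fun h => ht ⟨h.1, h.2.1⟩, mul_zero]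
  · simp [hx, sojournOcc]

-- After the shift `t = T_k + v`, predictability replaces the path by its truncation. The next
-- transition then enters only through the cutoff `v ≤ θ_{k+1}`, which makes the expression ready
-- for integration against `sojournLaw`.
open Classical in
theorem sojournOcc_eq (π : Policy M) (k : ℕ) (x : S) (a : A) (e : Path S) :
    sojournOcc π k x a e = if jumpState e k = some x then
      ∫⁻ v in Ioi (0 : ℝ), if ENNReal.ofReal v ≤ (e.1 (k + 1)).1 then
        disc M.α (jumpTime e k + ENNReal.ofReal v) *
          π.toFun (trunc k e) ((jumpTime e k).toNNReal + v.toNNReal) {some a} else 0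
      else 0 := by
  by_cases hx : jumpState e k = some x
  · have hT := jumpTime_ne_top hx
    simp only [sojournOcc, hx, and_true, if_true]
    set τ : ℝ := (jumpTime e k).toReal with hτ
    have hτ0 : 0 ≤ τ := ENNReal.toReal_nonneg
    have hTτ : jumpTime e k = ENNReal.ofReal τ := (ENNReal.ofReal_toReal hT).symm
    rw [← lintegral_indicator measurableSet_Ioi, ← lintegral_indicator measurableSet_Ioi,
      ← lintegral_add_right_eq_self _ τ]
    refine lintegral_congr fun v => ?_
    by_cases hv : 0 < v
    · have hadd : ENNReal.ofReal (v + τ) = jumpTime e k + ENNReal.ofReal v := by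
        rw [ENNReal.ofReal_add hv.le hτ0, hTτ, add_comm]
      have hlt : jumpTime e k < jumpTime e k + ENNReal.ofReal v :=
        ENNReal.lt_add_right hT (ENNReal.ofReal_pos.2 hv).ne'
      have hvτ : v + τ ∈ Ioi (0 : ℝ) := add_pos_of_pos_of_nonneg hv hτ0
      have hnn : (v + τ).toNNReal = (jumpTime e k).toNNReal + v.toNNReal := by
        rw [Real.toNNReal_add hv.le hτ0, add_comm, hτ]
        exact congrArg (· + v.toNNReal) Real.toNNReal_coe
      rw [indicator_of_mem hvτ, indicator_of_mem (show v ∈ Ioi (0 : ℝ) from hv),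
        ← disc_ofReal _ (le_of_lt hvτ), hadd, jumpTime_succ, ← hnn]
      simp only [hlt, true_and]
      have hiff : jumpTime e k + ENNReal.ofReal v ≤ jumpTime e k + (e.1 (k + 1)).1 ↔
          ENNReal.ofReal v ≤ (e.1 (k + 1)).1 := ENNReal.add_le_add_iff_left hT
      by_cases hle : ENNReal.ofReal v ≤ (e.1 (k + 1)).1
      · rw [if_pos (hiff.2 hle), if_pos hle, π.toFun_trunc]
        · exact Real.toNNReal_pos.2 hvτ
        · change ENNReal.ofReal (v + τ) ≤ _
          rw [hadd, jumpTime_succ]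
          gcongr
      · rw [if_neg (hiff.not.2 hle), if_neg hle, mul_zero]
    · rw [indicator_of_notMem (show v ∉ Ioi (0 : ℝ) from hv)]
      refine indicator_apply_eq_zero.2 fun _ => ?_
      rw [if_neg, mul_zero]
      rintro ⟨h, -⟩
      rw [hTτ] at h
      exact (ENNReal.lt_ofReal_iff_toReal_lt ENNReal.ofReal_ne_top).1 h |>.not_ge (by
        rw [ENNReal.toReal_ofReal hτ0]; linarith)
  · simp [hx, sojournOcc]

open Classical in
/-- The rate of the jumps from `x` to `y ≠ x`. -/
noncomputable def Model.rate (M : Model S A N) (x : S) (a : M.Adm x) (y : S) : ℝ :=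
  if y = x then 0 else M.q x a y

theorem Model.rate_nonneg (M : Model S A N) (x : S) (a : M.Adm x) (y : S) : 0 ≤ M.rate x a y := by
  unfold Model.rate
  split_ifs with h
  · exact le_rfl
  · exact M.q_nonneg x a y h

theorem Model.sum_rate (M : Model S A N) (x : S) (a : M.Adm x) :
    ∑ y, M.rate x a y = -M.q x a x := by
  classical
  have h := M.q_sum x a
  rw [← Finset.add_sum_erase _ _ (Finset.mem_univ x)] at h
  have hne : ∀ y ∈ Finset.univ.erase x, M.rate x a y = M.q x a y := fun y hy =>
    if_neg (Finset.ne_of_mem_erase hy)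
  rw [← Finset.add_sum_erase _ _ (Finset.mem_univ x), Model.rate, if_pos rfl, zero_add,
    Finset.sum_congr rfl hne]
  linarith

theorem jumpRate_of_state {π : Policy M} {k : ℕ} {e : Path S} {x : S} (h : jumpState e k = some x)
    (y : S) (t : ℝ) : jumpRate π k e y t = ∑ a : M.Adm x,
      π.toFun e ((jumpTime e k).toNNReal + t.toNNReal) {some (a : A)} *
        ENNReal.ofReal (M.rate x a y) := by
  simp only [jumpRate, h, Model.rate]
  split_ifs <;> simp

open Classical in
/-- The discounted flow from `x` to `y` during a sojourn, as a function of the truncated path and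
of the sojourn time. -/
theorem sum_sojournOcc_mul_rate (π : Policy M) (k : ℕ) (x y : S) (e : Path S) :
    ∑ a : M.Adm x, sojournOcc π k x a e * ENNReal.ofReal (M.rate x a y) =
      if jumpState (trunc k e) k = some x then
        ∫⁻ v in Ioi (0 : ℝ), if ENNReal.ofReal v ≤ (e.1 (k + 1)).1 then
          disc M.α (jumpTime (trunc k e) k + ENNReal.ofReal v) *
            jumpRate π k (trunc k e) y v else 0
      else 0 := by
  simp only [sojournOcc_eq, jumpState_trunc, jumpTime_trunc]
  by_cases hx : jumpState e k = some x
  · simp only [hx, if_true]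
    have hm : ∀ a : A, Measurable fun v : ℝ => (if ENNReal.ofReal v ≤ (e.1 (k + 1)).1 then
        disc M.α (jumpTime e k + ENNReal.ofReal v) *
          π.toFun (trunc k e) ((jumpTime e k).toNNReal + v.toNNReal) {some a} else 0) := by
      intro a
      refine Measurable.ite (measurableSet_le ENNReal.measurable_ofReal measurable_const)
        (((measurable_disc M.α).comp (measurable_const.add ENNReal.measurable_ofReal)).mul ?_)
        measurable_const
      exact (π.measurable_apply a).comp (measurable_const.prodMk
        (measurable_const.add measurable_real_toNNReal))
    simp_rw [← lintegral_mul_const _ (hm _)]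
    refine (lintegral_finsetSum Finset.univ fun (a : M.Adm x) _ =>
      (hm (a : A)).mul_const (ENNReal.ofReal (M.rate x a y))).symm.trans ?_
    refine lintegral_congr fun v => ?_
    rw [jumpRate_of_state ((jumpState_trunc k e).trans hx), jumpTime_trunc]
    split_ifs
    · rw [Finset.mul_sum]
      exact Finset.sum_congr rfl fun a _ => mul_assoc _ _ _
    · simp
  · simp [hx]

open Classical in
/-- The expected discounted flow from `x` to `y` at the `(k+1)`-st jump. -/
theorem lintegral_sum_sojournOcc_mul_rate (π : Policy M) (x₀ : S) (k : ℕ) (x y : S) :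
    ∑ a : M.Adm x, (∫⁻ e, sojournOcc π k x a e ∂(law π x₀)) * ENNReal.ofReal (M.rate x a y) =
      ∫⁻ e, (if jumpState e k = some x ∧ jumpState e (k + 1) = some y then
        disc M.α (jumpTime e (k + 1)) else 0) ∂(law π x₀) := by
  simp_rw [← lintegral_mul_const _ (measurable_sojournOcc π k x _)]
  rw [← lintegral_finsetSum _ fun a _ => (measurable_sojournOcc π k x _).mul_const _]
  simp_rw [sum_sojournOcc_mul_rate]
  have hstate : MeasurableSet {p : Path S × (ℝ≥0∞ × Option S) | jumpState p.1 k = some x} :=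
    ((measurable_jumpState k).comp measurable_fst) (measurableSet_singleton _)
  let g : (Path S × (ℝ≥0∞ × Option S)) × ℝ → ℝ≥0∞ := fun w =>
    if ENNReal.ofReal w.2 ≤ w.1.2.1 then
      disc M.α (jumpTime w.1.1 k + ENNReal.ofReal w.2) * jumpRate π k w.1.1 y w.2 else 0
  have hg : Measurable g := by
    have h1 : Measurable fun w : (Path S × (ℝ≥0∞ × Option S)) × ℝ => ENNReal.ofReal w.2 :=
      ENNReal.measurable_ofReal.comp measurable_snd
    have h2 : Measurable fun w : (Path S × (ℝ≥0∞ × Option S)) × ℝ => w.1.1 :=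
      measurable_fst.comp measurable_fst
    refine Measurable.ite (measurableSet_le h1 (measurable_fst.comp
      (measurable_snd.comp measurable_fst))) (((measurable_disc M.α).comp
      (((measurable_jumpTime k).comp h2).add h1)).mul ?_) measurable_const
    exact (measurable_jumpRate π k y).comp (h2.prodMk measurable_snd)
  let f : Path S × (ℝ≥0∞ × Option S) → ℝ≥0∞ := fun p =>
    if jumpState p.1 k = some x then ∫⁻ v in Ioi (0 : ℝ), g (p, v) else 0
  have hf : Measurable f := Measurable.ite hstate hg.lintegral_prod_right' measurable_const
  let f' : Path S × (ℝ≥0∞ × Option S) → ℝ≥0∞ := fun p =>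
    if jumpState p.1 k = some x ∧ p.2.2 = some y then
      disc M.α (jumpTime p.1 k + p.2.1) else 0
  have hf' : Measurable f' := Measurable.ite (hstate.inter
    ((measurable_snd.comp measurable_snd) (measurableSet_singleton _)))
    ((measurable_disc M.α).comp (((measurable_jumpTime k).comp measurable_fst).add
      (measurable_fst.comp measurable_snd))) measurable_const
  have hR : ∀ e : Path S, (if jumpState e k = some x ∧ jumpState e (k + 1) = some y then
      disc M.α (jumpTime e (k + 1)) else 0) = f' (trunc k e, e.1 (k + 1)) := fun e => by
    simp only [f', jumpState_trunc, jumpTime_trunc, jumpTime_succ]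
    rfl
  simp_rw [hR]
  -- Both sides are conditioned on the first `k` jumps. It remains to compare, for a fixed truncated
  -- path, two integrals over the next transition.
  refine (lintegral_law_step π x₀ k hf).trans (Eq.trans ?_ (lintegral_law_step π x₀ k hf').symm)
  refine lintegral_congr fun e => ?_
  generalize trunc k e = ω
  have := isProbabilityMeasure_sojournLaw π k ω
  rw [lintegral_sojournLaw π k ω (f := fun z => f' (ω, z)) (hf'.comp measurable_prodMk_left)]
  simp only [f, f']
  by_cases hx : jumpState ω k = some x
  · simp only [hx, if_true, true_and]
    have hgω : Measurable (Function.uncurry fun (z : ℝ≥0∞ × Option S) (v : ℝ) => g ((ω, z), v)) :=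
      hg.comp ((measurable_prodMk_left.comp measurable_fst).prodMk measurable_snd)
    -- After exchanging the integrals, the cutoff `v ≤ θ` contributes its probability `exp(-∫₀ᵛ
    -- m_k)`. Rate times survival probability is the density of a jump to `y` at `v`, which is the
    -- other side.
    rw [lintegral_lintegral_swap hgω.aemeasurable, Finset.sum_eq_single y]
    · simp only [reduceCtorEq, if_false, mul_zero, add_zero, if_true]
      refine setLIntegral_congr_fun measurableSet_Ioi fun v hv => ?_
      have hm : MeasurableSet {z : ℝ≥0∞ × Option S | ENNReal.ofReal v ≤ z.1} :=
        measurableSet_le measurable_const measurable_fst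
      have hind : ∀ z : ℝ≥0∞ × Option S, g ((ω, z), v) =
          {z : ℝ≥0∞ × Option S | ENNReal.ofReal v ≤ z.1}.indicator (fun _ =>
            disc M.α (jumpTime ω k + ENNReal.ofReal v) * jumpRate π k ω y v) z := fun z => by
        by_cases hz : ENNReal.ofReal v ≤ z.1 <;> simp [g, hz]
      simp_rw [hind]
      rw [lintegral_indicator_const hm, sojournLaw_ge π k ω hv]
      ring
    · intro z _ hz
      simp [hz]
    · simp
  · simp [hx]

open Classical in
theorem measurable_disc_jumpTime (k : ℕ) (x : S) (j : ℕ) (α : ℝ) : Measurable fun e : Path S =>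
    if jumpState e k = some x then disc α (jumpTime e j) else 0 :=
  Measurable.ite (measurable_jumpState k (measurableSet_singleton _))
    ((measurable_disc α).comp (measurable_jumpTime j)) measurable_const

open Classical in
theorem measurable_disc_jump (k : ℕ) (x y : S) (α : ℝ) : Measurable fun e : Path S =>
    if jumpState e k = some x ∧ jumpState e (k + 1) = some y then
      disc α (jumpTime e (k + 1)) else 0 :=
  Measurable.ite ((measurable_jumpState k (measurableSet_singleton _)).inter
    (measurable_jumpState (k + 1) (measurableSet_singleton _)))
    ((measurable_disc α).comp (measurable_jumpTime _)) measurable_const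

open Classical in
/-- The discounted occupation measure balances the discounted flows. -/
theorem occ_balance (π : Policy M) (x₀ x : S) :
    ENNReal.ofReal M.α * ∑ a : M.Adm x, occ π x₀ x a +
        ∑ y, ∑ a : M.Adm x, occ π x₀ x a * ENNReal.ofReal (M.rate x a y) =
      (if x = x₀ then 1 else 0) +
        ∑ z, ∑ a : M.Adm z, occ π x₀ z a * ENNReal.ofReal (M.rate z a x) := by
  have hflow : ∀ z y, ∑ a : M.Adm z, occ π x₀ z a * ENNReal.ofReal (M.rate z a y) =
      ∑' k, ∫⁻ e, (if jumpState e k = some z ∧ jumpState e (k + 1) = some y then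
        disc M.α (jumpTime e (k + 1)) else 0) ∂(law π x₀) := fun z y => by
    simp_rw [occ_eq_tsum, ← ENNReal.tsum_mul_right]
    rw [← Summable.tsum_finsetSum fun _ _ => ENNReal.summable]
    exact tsum_congr fun k => lintegral_sum_sojournOcc_mul_rate π x₀ k z y
  -- Summing over destinations loses only the transition to `x_∞`, where `T_{k+1} = ∞` and the
  -- discount factor is zero.
  have hout : ∀ k, ∑ y, ∫⁻ e, (if jumpState e k = some x ∧ jumpState e (k + 1) = some y then
        disc M.α (jumpTime e (k + 1)) else 0) ∂(law π x₀) =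
      ∫⁻ e, (if jumpState e k = some x then disc M.α (jumpTime e (k + 1)) else 0)
        ∂(law π x₀) := fun k => by
    rw [← lintegral_finsetSum _ fun y _ => measurable_disc_jump k x y M.α]
    refine lintegral_congr fun e => ?_
    rcases hs : jumpState e (k + 1) with _ | y
    · simp [(jumpState_eq_none_iff e (k + 1)).1 hs, disc_top]
    · by_cases hx : jumpState e k = some x <;> simp [hx]
  have hin : ∀ k, ∑ z, ∫⁻ e, (if jumpState e k = some z ∧ jumpState e (k + 1) = some x then
        disc M.α (jumpTime e (k + 1)) else 0) ∂(law π x₀) =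
      ∫⁻ e, (if jumpState e (k + 1) = some x then disc M.α (jumpTime e (k + 1)) else 0)
        ∂(law π x₀) := fun k => by
    rw [← lintegral_finsetSum _ fun z _ => measurable_disc_jump k z x M.α]
    refine lintegral_congr fun e => ?_
    rcases hs : jumpState e k with _ | z
    · have : jumpState e (k + 1) = none := (e.2.2.2 k).2.2 hs
      simp [this]
    · by_cases hx : jumpState e (k + 1) = some x <;> simp [hx]
  have hstep : ∀ k, ENNReal.ofReal M.α * ∑ a : M.Adm x, (∫⁻ e, sojournOcc π k x a e ∂(law π x₀)) +
      (∫⁻ e, (if jumpState e k = some x then disc M.α (jumpTime e (k + 1)) else 0)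
        ∂(law π x₀)) =
      ∫⁻ e, (if jumpState e k = some x then disc M.α (jumpTime e k) else 0) ∂(law π x₀) :=
      fun k => by
    rw [← lintegral_finsetSum _ fun a _ => measurable_sojournOcc π k x _,
      ← lintegral_const_mul _ (Finset.measurable_sum _ fun a _ => measurable_sojournOcc π k x _),
      ← lintegral_add_right _ (measurable_disc_jumpTime k x (k + 1) M.α)]
    exact lintegral_congr fun e => sojournOcc_balance π k x e
  have hzero : ∫⁻ e, (if jumpState e 0 = some x then disc M.α (jumpTime e 0) else 0) ∂(law π x₀) =
      if x = x₀ then 1 else 0 := by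
    have h : ∀ᵐ e ∂(law π x₀), (if jumpState e 0 = some x then disc M.α (jumpTime e 0) else 0) =
        if x = x₀ then (1 : ℝ≥0∞) else 0 := by
      filter_upwards [law_ae_jumpState_zero π x₀] with e he
      rw [he, jumpTime_zero, disc_zero]
      simp [eq_comm]
    rw [lintegral_congr_ae h, lintegral_const, measure_univ, mul_one]
  simp_rw [hflow]
  simp_rw [occ_eq_tsum]
  rw [← Summable.tsum_finsetSum fun _ _ => ENNReal.summable, ← ENNReal.tsum_mul_left,
    ← Summable.tsum_finsetSum fun _ _ => ENNReal.summable,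
    ← Summable.tsum_finsetSum fun _ _ => ENNReal.summable]
  simp_rw [hout, hin]
  rw [← ENNReal.tsum_add]
  simp_rw [hstep]
  -- The left side has become the sum over `k` of the expected `e^{-αT_k}` on `X_k = x`. Its term `k
  -- = 0` is the initial mass and the rest is the discounted inflow.
  rw [tsum_eq_zero_add' ENNReal.summable, hzero]

end Occupation

/-! ### Criteria as linear functionals of occupation measures, and the correspondence with the
linear program. -/

section Criteria

variable {S A : Type*} [Fintype S] [MeasurableSpace S] [MeasurableSingletonClass S]
  [MeasurableSpace A] [MeasurableSingletonClass A] {N : ℕ} {M : Model S A N}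

-- The diagonal rates are restored: the outflow from `x` is `-q(x|x,a)` times the occupation by
-- `sum_rate`, and it is the diagonal term of the full balance equation moved across.
open Classical in
theorem occ_toReal_balance (π : Policy M) (x₀ x : S) :
    M.α * ∑ a : M.Adm x, (occ π x₀ x a).toReal = (if x = x₀ then 1 else 0) +
      ∑ z, ∑ a : M.Adm z, M.q z a x * (occ π x₀ z a).toReal := by
  have hO := occ_ne_top π x₀
  have hOr : ∀ z (a : M.Adm z) y, occ π x₀ z a * ENNReal.ofReal (M.rate z a y) ≠ ∞ :=
    fun z a y => ENNReal.mul_ne_top (hO z a) ENNReal.ofReal_ne_top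
  have hs1 : ∑ a : M.Adm x, occ π x₀ x a ≠ ∞ := ENNReal.sum_ne_top.2 fun a _ => hO x a
  have hs2 : ∀ z y, ∑ a : M.Adm z, occ π x₀ z a * ENNReal.ofReal (M.rate z a y) ≠ ∞ :=
    fun z y => ENNReal.sum_ne_top.2 fun a _ => hOr z a y
  have hs3 : ∀ z y, (∑ a : M.Adm z, occ π x₀ z a * ENNReal.ofReal (M.rate z a y)).toReal =
      ∑ a : M.Adm z, M.rate z a y * (occ π x₀ z a).toReal := fun z y => by
    rw [ENNReal.toReal_sum fun a _ => hOr z a y]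
    refine Finset.sum_congr rfl fun a _ => ?_
    rw [ENNReal.toReal_mul, ENNReal.toReal_ofReal (M.rate_nonneg z a y), mul_comm]
  have h := congrArg ENNReal.toReal (occ_balance π x₀ x)
  rw [ENNReal.toReal_add (ENNReal.mul_ne_top ENNReal.ofReal_ne_top hs1)
    (ENNReal.sum_ne_top.2 fun y _ => hs2 x y), ENNReal.toReal_add (by split_ifs <;> simp)
    (ENNReal.sum_ne_top.2 fun z _ => hs2 z x), ENNReal.toReal_mul,
    ENNReal.toReal_ofReal M.α_pos.le, ENNReal.toReal_sum fun (a : M.Adm x) _ => hO x a,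
    ENNReal.toReal_sum fun y _ => hs2 x y, ENNReal.toReal_sum fun z _ => hs2 z x] at h
  simp_rw [hs3] at h
  have hout : ∑ y, ∑ a : M.Adm x, M.rate x a y * (occ π x₀ x a).toReal =
      -∑ a : M.Adm x, M.q x a x * (occ π x₀ x a).toReal := by
    rw [Finset.sum_comm, ← Finset.sum_neg_distrib]
    refine Finset.sum_congr rfl fun a _ => ?_
    rw [← Finset.sum_mul, M.sum_rate, neg_mul]
  have hin : ∑ z, ∑ a : M.Adm z, M.q z a x * (occ π x₀ z a).toReal =
      ∑ a : M.Adm x, M.q x a x * (occ π x₀ x a).toReal +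
        ∑ z, ∑ a : M.Adm z, M.rate z a x * (occ π x₀ z a).toReal := by
    rw [← Finset.add_sum_erase _ _ (Finset.mem_univ x),
      ← Finset.add_sum_erase _ (fun z => ∑ a : M.Adm z, M.rate z a x * (occ π x₀ z a).toReal)
        (Finset.mem_univ x)]
    simp only [Model.rate, if_true, zero_mul, Finset.sum_const_zero, zero_add]
    congr 1
    refine Finset.sum_congr rfl fun z hz => ?_
    simp [(Finset.ne_of_mem_erase hz).symm]
  have hone : ((if x = x₀ then 1 else 0 : ℝ≥0∞)).toReal = if x = x₀ then 1 else 0 := by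
    split_ifs <;> simp
  rw [hout, hone] at h
  linarith

open Classical in
theorem measurable_occ_integrand (π : Policy M) (x : S) (a : A) :
    Measurable fun p : Path S × ℝ => if stateLeft p.1 p.2.toNNReal = some x then
      π.toFun p.1 p.2.toNNReal {some a} else 0 := by
  have h : Measurable fun p : Path S × ℝ => (p.1, p.2.toNNReal) :=
    measurable_fst.prodMk measurable_snd.real_toNNReal
  exact Measurable.ite (h (predictable_le _ (measurableSet_stateLeft x)))
    (measurable_toFun_real π a) measurable_const

/-- As `S` and each `A(x)` are finite, `u` is a finite combination of indicators of pairs. All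
occupations are finite, so the Bochner integrals split and can be read off from the `ℝ≥0∞`-valued
ones. -/
theorem discountedFrom_eq (π : Policy M) (u : (x : S) → M.Adm x → ℝ) (x₀ : S) :
    discountedFrom π u x₀ = ∑ x, ∑ a : M.Adm x, u x a * (occ π x₀ x a).toReal := by
  classical
  let w : (x : S) → A → Path S → ℝ → ℝ≥0∞ := fun x a e t =>
    if stateLeft e t.toNNReal = some x then π.toFun e t.toNNReal {some a} else 0
  have hw1 : ∀ x a e t, w x a e t ≤ 1 := fun x a e t => by
    have := π.prob e t.toNNReal
    simp only [w]
    split_ifs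
    · exact prob_le_one
    · exact zero_le
  have hwm : ∀ x a t, Measurable fun e => w x a e t := fun x a t =>
    (measurable_occ_integrand π x a).comp measurable_prodMk_right
  have hwtop : ∀ x a t, ∫⁻ e, w x a e t ∂(law π x₀) ≠ ∞ := fun x a t =>
    ne_top_of_le_ne_top ENNReal.one_ne_top
      ((lintegral_mono fun e => hw1 x a e t).trans_eq (by simp))
  have hinner : ∀ t : ℝ, ∫ e, (match stateLeft e t.toNNReal with
      | none => 0
      | some z => ∑ a : M.Adm z, u z a * (π.toFun e t.toNNReal).real {some (a : A)}) ∂(law π x₀) =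
      ∑ x, ∑ a : M.Adm x, u x a * (∫⁻ e, w x a e t ∂(law π x₀)).toReal := by
    intro t
    have hint : ∀ x (a : A), Integrable (fun e => (w x a e t).toReal) (law π x₀) := fun x a =>
      integrable_toReal_of_lintegral_ne_top (hwm x a t).aemeasurable (hwtop x a t)
    have hpt : ∀ e, (match stateLeft e t.toNNReal with
        | none => 0
        | some z => ∑ a : M.Adm z, u z a * (π.toFun e t.toNNReal).real {some (a : A)}) =
        ∑ x, ∑ a : M.Adm x, u x a * (w x a e t).toReal := by
      intro e
      simp only [w]
      rcases stateLeft e t.toNNReal with _ | z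
      · simp
      · rw [Finset.sum_eq_single z]
        · simp [Measure.real]
        · intro y _ hy
          simp [hy.symm]
        · simp
    simp_rw [hpt]
    rw [integral_finsetSum _ fun x _ => integrable_finsetSum _ fun (a : M.Adm x) _ =>
      (hint x a).const_mul (u x a)]
    refine Finset.sum_congr rfl fun x _ => ?_
    rw [integral_finsetSum _ fun (a : M.Adm x) _ => (hint x a).const_mul (u x a)]
    refine Finset.sum_congr rfl fun a _ => ?_
    rw [integral_const_mul, integral_toReal (hwm x a t).aemeasurable
      (ae_of_all _ fun e => (hw1 x a e t).trans_lt ENNReal.one_lt_top)]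
  let g : (x : S) → A → ℝ → ℝ≥0∞ := fun x a t =>
    ENNReal.ofReal (Real.exp (-M.α * t)) * ∫⁻ e, w x a e t ∂(law π x₀)
  have hgm : ∀ x a, Measurable (g x a) := fun x a =>
    (measurable_discountFactor M.α).mul (measurable_occ_integrand π x a).lintegral_prod_left'
  have hgocc : ∀ x a, ∫⁻ t in Ioi (0 : ℝ), g x a t = occ π x₀ x a := fun x a => rfl
  have hgint : ∀ x a, IntegrableOn (fun t => (g x a t).toReal) (Ioi 0) := fun x a =>
    integrable_toReal_of_lintegral_ne_top (hgm x a).aemeasurable (occ_ne_top π x₀ x a)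
  have hpt : ∀ t : ℝ, Real.exp (-M.α * t) *
      ∑ x, ∑ a : M.Adm x, u x a * (∫⁻ e, w x a e t ∂(law π x₀)).toReal =
      ∑ x, ∑ a : M.Adm x, u x a * (g x a t).toReal := fun t => by
    simp only [g, ENNReal.toReal_mul, ENNReal.toReal_ofReal (Real.exp_pos _).le, Finset.mul_sum]
    refine Finset.sum_congr rfl fun x _ => Finset.sum_congr rfl fun a _ => ?_
    ring
  refine (integral_congr_ae (ae_of_all _ fun t =>
    (congrArg (Real.exp (-M.α * t) * ·) (hinner t)).trans (hpt t))).trans ?_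
  rw [integral_finsetSum _ fun x _ => integrable_finsetSum _ fun (a : M.Adm x) _ =>
    (hgint x a).const_mul (u x a)]
  refine Finset.sum_congr rfl fun x _ => ?_
  rw [integral_finsetSum _ fun (a : M.Adm x) _ => (hgint x a).const_mul (u x a)]
  refine Finset.sum_congr rfl fun a _ => ?_
  rw [integral_const_mul, integral_toReal (hgm x a).aemeasurable
    (ae_of_all _ fun t => ENNReal.mul_lt_top ENNReal.ofReal_lt_top (hwtop x a t).lt_top), hgocc]

/-- The normalized discounted occupation measure of a policy. -/
noncomputable def occupation (π : Policy M) (k : M.K) : ℝ :=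
  M.α * ∑ x₀, M.γ x₀ * (occ π x₀ k.1 k.2).toReal

theorem occupation_nonneg (π : Policy M) (k : M.K) : 0 ≤ occupation π k :=
  mul_nonneg M.α_pos.le (Finset.sum_nonneg fun x₀ _ =>
    mul_nonneg (M.γ_nonneg x₀) ENNReal.toReal_nonneg)

theorem sum_mul_occupation (π : Policy M) (x : S) (f : M.Adm x → ℝ) :
    ∑ a, f a * occupation π ⟨x, a⟩ =
      M.α * ∑ x₀, M.γ x₀ * ∑ a : M.Adm x, f a * (occ π x₀ x a).toReal := by
  simp only [occupation, Finset.mul_sum]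
  rw [Finset.sum_comm]
  refine Finset.sum_congr rfl fun x₀ _ => Finset.sum_congr rfl fun a _ => ?_
  ring

theorem sum_sum_mul_occupation (π : Policy M) (u : (x : S) → M.Adm x → ℝ) :
    ∑ x, ∑ a, u x a * occupation π ⟨x, a⟩ =
      M.α * ∑ x₀, M.γ x₀ * ∑ x, ∑ a : M.Adm x, u x a * (occ π x₀ x a).toReal := by
  simp_rw [sum_mul_occupation, ← Finset.mul_sum]
  rw [Finset.sum_comm]
  simp_rw [← Finset.mul_sum]

theorem discounted_eq_occupation (π : Policy M) (u : (x : S) → M.Adm x → ℝ) :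
    M.α * discounted π u = ∑ x, ∑ a, u x a * occupation π ⟨x, a⟩ := by
  rw [sum_sum_mul_occupation, discounted]
  simp_rw [discountedFrom_eq]

theorem occupation_balance (π : Policy M) (x : S) :
    M.α * ∑ a, occupation π ⟨x, a⟩ =
      M.α * M.γ x + ∑ y, ∑ a, M.q y a x * occupation π ⟨y, a⟩ := by
  classical
  have h1 := sum_mul_occupation π x fun _ => 1
  simp only [one_mul] at h1
  rw [h1, sum_sum_mul_occupation π fun y a => M.q y a x, ← mul_add]
  congr 1
  rw [Finset.mul_sum]
  have h2 : ∀ x₀, M.α * (M.γ x₀ * ∑ a : M.Adm x, (occ π x₀ x a).toReal) =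
      (if x = x₀ then M.γ x₀ else 0) +
        M.γ x₀ * ∑ z, ∑ a : M.Adm z, M.q z a x * (occ π x₀ z a).toReal := fun x₀ => by
    rw [mul_left_comm, occ_toReal_balance, mul_add]
    simp
  simp_rw [h2]
  rw [Finset.sum_add_distrib]
  simp

theorem lpFeasible_occupation {π : Policy M} (hπ : π ∈ feasiblePolicies M) :
    M.LPFeasible (occupation π) where
  cost n := by
    rw [← discounted_eq_occupation]
    exact mul_le_mul_of_nonneg_left (hπ n) M.α_pos.le
  balance x := occupation_balance π x
  nonneg := occupation_nonneg π

theorem lpObjective_occupation (π : Policy M) :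
    M.LPObjective (occupation π) = -discounted π M.r := by
  have h := discounted_eq_occupation π M.r
  have hα := M.α_pos.ne'
  have h2 : M.LPObjective (occupation π) =
      -(1 / M.α) * ∑ x, ∑ a, M.r x a * occupation π ⟨x, a⟩ := by
    simp only [Model.LPObjective, Finset.mul_sum]
    refine Finset.sum_congr rfl fun x _ => Finset.sum_congr rfl fun a _ => ?_
    ring
  rw [h2, ← h]
  field_simp

/-- On `ξ_{t-} = x` the probability of `a` is the constant `φ x a`, which leaves the integral; the
remaining factor is the discounted time at `x`. -/
theorem Policy.IsStationary.occ_eq {π : Policy M} {φ : (x : S) → M.Adm x → ℝ}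
    (hπ : π.IsStationary φ) (hφ : M.IsStationaryKernel φ) (x₀ x : S) (a : M.Adm x) :
    occ π x₀ x a = ENNReal.ofReal (φ x a) * ∑ b : M.Adm x, occ π x₀ x b := by
  classical
  let B : ℝ≥0∞ := ∫⁻ t in Ioi (0 : ℝ), ENNReal.ofReal (Real.exp (-M.α * t)) *
    ∫⁻ e, (if stateLeft e t.toNNReal = some x then 1 else 0) ∂(law π x₀)
  have hB : ∀ a : M.Adm x, occ π x₀ x a = ENNReal.ofReal (φ x a) * B := fun a => by
    have hpt : ∀ (e : Path S) (t : ℝ), (if stateLeft e t.toNNReal = some x then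
        π.toFun e t.toNNReal {some (a : A)} else 0) =
        ENNReal.ofReal (φ x a) * if stateLeft e t.toNNReal = some x then 1 else 0 := by
      intro e t
      by_cases hs : stateLeft e t.toNNReal = some x
      · rw [if_pos hs, if_pos hs, hπ e t.toNNReal, hs, mul_one]
        simp only [Measure.finsetSum_apply, Measure.smul_apply, smul_eq_mul]
        rw [Finset.sum_eq_single a]
        · simp
        · intro b _ hb
          have : (b : A) ≠ a := fun h => hb (Subtype.ext h)
          simp [this]
        · simp
      · simp [hs]
    rw [occ]
    simp_rw [hpt, lintegral_const_mul' _ _ (ENNReal.ofReal_ne_top (r := φ x a)),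
      mul_left_comm _ (ENNReal.ofReal (φ x a))]
    rw [lintegral_const_mul' _ _ ENNReal.ofReal_ne_top]
  have hsum : ∑ b : M.Adm x, occ π x₀ x b = B := by
    simp_rw [hB]
    rw [← Finset.sum_mul, ← ENNReal.ofReal_sum_of_nonneg fun a _ => (hφ x).1 a, (hφ x).2,
      ENNReal.ofReal_one, one_mul]
  rw [hsum, hB]

theorem Policy.IsStationary.occupation_eq {π : Policy M} {φ : (x : S) → M.Adm x → ℝ}
    (hπ : π.IsStationary φ) (hφ : M.IsStationaryKernel φ) (x : S) (a : M.Adm x) :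
    occupation π ⟨x, a⟩ = φ x a * M.marginal (occupation π) x := by
  have h1 := sum_mul_occupation π x fun _ => 1
  simp only [one_mul] at h1
  rw [Model.marginal, h1, occupation, mul_left_comm (φ x a), Finset.mul_sum _ _ (φ x a)]
  congr 1
  refine Finset.sum_congr rfl fun x₀ _ => ?_
  rw [hπ.occ_eq hφ x₀ x a, ENNReal.toReal_mul, ENNReal.toReal_ofReal ((hφ x).1 a),
    ENNReal.toReal_sum fun (b : M.Adm x) _ => occ_ne_top π x₀ x b]
  ring

/-- The stationary policy built from a feasible point of the linear program has this point as its
occupation measure. -/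
theorem Model.LPFeasible.occupation_eq {η : M.K → ℝ} (hη : M.LPFeasible η)
    {sel : (x : S) → M.Adm x} {π : Policy M} (hπ : π.IsStationary (M.policyOf η sel)) :
    occupation π = η := by
  have hφ := hη.isStationaryKernel sel
  set φ := M.policyOf η sel with hφdef
  have h1 : ∀ x a, occupation π ⟨x, a⟩ = φ x a * M.marginal (occupation π) x :=
    hπ.occupation_eq hφ
  have h2 : ∀ x a, η ⟨x, a⟩ = φ x a * M.marginal η x := fun x a =>
    (hη.policyOf_mul_marginal sel x a).symm
  -- Both marginals solve the balance equations with the rates averaged under `φ` and the same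
  -- source `α γ`, so their difference solves the homogeneous system.
  have hv : (fun x => M.marginal (occupation π) x - M.marginal η x) = 0 := by
    refine eq_zero_of_discounted_stationary (Q := fun y x => ∑ a, φ y a * M.q y a x)
      (fun y x hyx => Finset.sum_nonneg fun a _ =>
        mul_nonneg ((hφ y).1 a) (M.q_nonneg y a x hyx)) (fun y => ?_) M.α_pos fun x => ?_
    · rw [Finset.sum_comm]
      simp [← Finset.mul_sum, M.q_sum]
    · have e1 := occupation_balance π x
      have e2 := hη.balance x
      simp_rw [h1] at e1
      simp_rw [h2] at e2
      have e3 : ∀ m : S → ℝ, ∑ y, (∑ a, φ y a * M.q y a x) * m y =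
          ∑ y, ∑ a, M.q y a x * (φ y a * m y) := fun m => by
        refine Finset.sum_congr rfl fun y _ => ?_
        rw [Finset.sum_mul]
        exact Finset.sum_congr rfl fun a _ => by ring
      simp_rw [mul_sub]
      rw [Finset.sum_sub_distrib, e3, e3]
      simp_rw [← Finset.sum_mul, (hφ x).2, one_mul] at e1 e2
      linarith
  funext ⟨x, a⟩
  rw [h1, h2, sub_eq_zero.1 (congrFun hv x)]

end Criteria

end CTMDP

/-! ### The main theorem: transfer of optimality from the linear program to policies. -/

theorem mainTheorem10 {S A : Type*} [Fintype S] [MeasurableSpace S] [MeasurableSingletonClass S]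
    [MeasurableSpace A] [MeasurableSingletonClass A] {N : ℕ} (M : CTMDP.Model S A N)
    (η : M.K → ℝ) (hopt : M.LPOptimal η) (hbasic : M.LPBasic η) (sel : (x : S) → M.Adm x) :
    M.IsStationaryKernel (M.policyOf η sel) ∧
      (∃ π : CTMDP.Policy M, π.IsStationary (M.policyOf η sel) ∧ CTMDP.IsConstrainedOptimal π) ∧
      M.randomizations (M.policyOf η sel) ≤ N := by
  obtain ⟨hη, hmin⟩ := hopt
  have hφ := hη.isStationaryKernel sel
  refine ⟨hφ, ?_, hbasic.randomizations_le sel⟩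
  obtain ⟨π, hπ⟩ := hφ.exists_policy
  have hocc := hη.occupation_eq hπ
  have hfeas : π ∈ CTMDP.feasiblePolicies M := fun n => by
    have h := hη.cost n
    rw [← hocc, ← CTMDP.discounted_eq_occupation] at h
    exact le_of_mul_le_mul_left h M.α_pos
  -- The supremum is attained at `π`, so only the upper bound remains. It is optimality of `η`
  -- tested against the occupation measure of an arbitrary feasible policy.
  refine ⟨π, hπ, hfeas, ?_, fun b hb => hb ⟨π, hfeas, rfl⟩⟩
  rintro _ ⟨π', hπ', rfl⟩
  have h := hmin _ (CTMDP.lpFeasible_occupation hπ')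
  rw [← hocc, CTMDP.lpObjective_occupation, CTMDP.lpObjective_occupation] at h
  exact neg_le_neg_iff.1 h
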